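/- **Model.** Let $\mathbb F$ be a finite field. A problem with $n$ inputs and $m$ queries is a function $f\colon\mathbb F^n\times[m]\to\mathbb F$. A non-adaptive static data structure for $f$ with space $s$ and query time $t$ consists of an arbitrary preprocessing map $P\colon\mathbb F^n\to\mathbb F^s$ and, for each query $i\in[m]$, a set $Q_i\subseteq[s]$ of at most $t$ cells (depending only on $i$) and a function $A_i\colon\mathbb F^{Q_i}\to\mathbb F$ such that $A_i(P(x)|_{Q_i})=f(x,i)$ for all $x\in\mathbb F^n$. A family of problems, one for each $n$, is explicit if a single algorithm computes $f(x,i)$ from $(n,i,x)$ in time polynomial in $n$. A function $f\colon\mathbb F^n\to\mathbb F^m$ is $k$-wise independent if for every set of $k$ outputs, a uniformly random input induces the uniform distribution on these outputs. Logarithms are to base two. **Theorem 1.** Fix a finite field $\mathbb F$ and $m=m(n)=\mathrm{poly}(n)$, where $m(n)\ge n$ for all sufficiently large $n$. There are $k=k(n)=\Theta(n/\log n)$ and matrices $M_n\in\mathbb F^{n\times m}$ such that the problem of computing $x^{\top}M_n$ (the $i$-th query asks for the $i$-th entry) is explicit and, for all sufficiently large $n$, is $k$-wise independent, and $M_n$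 is a parity-check matrix of a linear code with minimum distance at least $k+1$; and this family of problems satisfies the following. 1. Every non-adaptive static data structure solving it with query time $t=2$ requires space $s\ge m-\widetilde O(m/n)$, that is, there are constants $C$ and $a$ such that $s\ge m-C\,\frac mn(\log n)^a$ for all sufficiently large $n$. 2. There is a constant $c>0$ such that for all sufficiently large $n$ and every $t\ge3$, every non-adaptive static data structure solving it with query time $t$ requires space $$s\ \ge\ c\cdot n\left(\frac mn\right)^{1/(t-1)}\frac{1}{2^t\log n\,\log m}.$$ Moreover, (1) and (2) hold for every family of problems $f_n\colon\mathbb F^n\to\mathbb F^{m}$ that is $k$-wise independent for all sufficiently large $n$, for some $k=k(n)=\Theta(n/\log n)$ (with constants that may depend on the family). -/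

import Mathlib

open Filter Asymptotics

/-! ### Non-adaptive static data structures in the cell-probe model -/

/-- `HasNonAdaptiveDS f s t`: the problem `f` with inputs in `F^n` and `m` queries is solved by a
non-adaptive static data structure with `s` memory cells and query time `t`.  The preprocessing
`pre` maps the input to the memory contents, query `i` probes the set `probe i` of at most `t`
cells, which depends on `i` only, and `answer i` computes the answer from the contents of these
cells. -/
def HasNonAdaptiveDS {F : Type*} {n m : ℕ} (f : (Fin n → F) → Fin m → F) (s t : ℕ) : Prop :=
  ∃ (pre : (Fin n → F) → Fin s → F) (probe : Fin m → Finset (Fin s))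
    (answer : (i : Fin m) → (probe i → F) → F),
    (∀ i, (probe i).card ≤ t) ∧ ∀ x i, answer i (fun c => pre x c) = f x i

/-- `f : F^n → F^m` is `k`-wise independent: for every set `S` of `k` outputs, the uniform
distribution of the input induces the uniform distribution on the outputs in `S`. -/
def KWiseIndependent {F : Type*} [Fintype F] [Nonempty F] {n m : ℕ} (k : ℕ)
    (f : (Fin n → F) → Fin m → F) : Prop :=
  ∀ S : Finset (Fin m), S.card = k →
    (PMF.uniformOfFintype (Fin n → F)).map (fun x (i : S) => f x i) =
      PMF.uniformOfFintype (S → F)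

/-! ### Polynomial time: the unit-cost random access machine with addition and subtraction -/

/-- A configuration: registers and random access memory, both holding natural numbers. -/
structure RAMState where
  reg : ℕ → ℕ
  mem : ℕ → ℕ

/-- Programs of the random access machine. -/
inductive RAMProg : Type
  /-- `R_d := c` -/
  | const (d c : ℕ) : RAMProg
  /-- `R_d := R_a + R_b` -/
  | add (d a b : ℕ) : RAMProg
  /-- `R_d := max (R_a - R_b) 0` -/
  | sub (d a b : ℕ) : RAMProg
  /-- `R_d := M[R_a]` -/
  | load (d a : ℕ) : RAMProg
  /-- `M[R_a] := R_b` -/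
  | store (a b : ℕ) : RAMProg
  /-- first `p`, then `q` -/
  | seq (p q : RAMProg) : RAMProg
  /-- if `R_r ≠ 0` then `p` else `q` -/
  | ite (r : ℕ) (p q : RAMProg) : RAMProg
  /-- while `R_r ≠ 0` do `p` -/
  | loop (r : ℕ) (p : RAMProg) : RAMProg

/-- `RAMExec p σ T τ`: started in `σ`, the program `p` halts in `τ` after exactly `T` steps, where
each elementary instruction and each test costs one step. -/
inductive RAMExec : RAMProg → RAMState → ℕ → RAMState → Prop
  | const (d c : ℕ) (σ : RAMState) :
      RAMExec (.const d c) σ 1 ⟨Function.update σ.reg d c, σ.mem⟩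
  | add (d a b : ℕ) (σ : RAMState) :
      RAMExec (.add d a b) σ 1 ⟨Function.update σ.reg d (σ.reg a + σ.reg b), σ.mem⟩
  | sub (d a b : ℕ) (σ : RAMState) :
      RAMExec (.sub d a b) σ 1 ⟨Function.update σ.reg d (σ.reg a - σ.reg b), σ.mem⟩
  | load (d a : ℕ) (σ : RAMState) :
      RAMExec (.load d a) σ 1 ⟨Function.update σ.reg d (σ.mem (σ.reg a)), σ.mem⟩
  | store (a b : ℕ) (σ : RAMState) :
      RAMExec (.store a b) σ 1 ⟨σ.reg, Function.update σ.mem (σ.reg a) (σ.reg b)⟩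
  | seq {p q : RAMProg} {σ σ' τ : RAMState} {T T' : ℕ} :
      RAMExec p σ T σ' → RAMExec q σ' T' τ → RAMExec (.seq p q) σ (T + T') τ
  | iteTrue {r : ℕ} {p q : RAMProg} {σ τ : RAMState} {T : ℕ} :
      σ.reg r ≠ 0 → RAMExec p σ T τ → RAMExec (.ite r p q) σ (T + 1) τ
  | iteFalse {r : ℕ} {p q : RAMProg} {σ τ : RAMState} {T : ℕ} :
      σ.reg r = 0 → RAMExec q σ T τ → RAMExec (.ite r p q) σ (T + 1) τ
  | loopDone {r : ℕ} {p : RAMProg} {σ : RAMState} :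
      σ.reg r = 0 → RAMExec (.loop r p) σ 1 σ
  | loopStep {r : ℕ} {p : RAMProg} {σ σ' τ : RAMState} {T T' : ℕ} :
      σ.reg r ≠ 0 → RAMExec p σ T σ' → RAMExec (.loop r p) σ' T' τ →
        RAMExec (.loop r p) σ (T + T' + 1) τ

/-- The initial configuration on input `(n, i, x)`: `R_0 = n`, `R_1 = i`, the memory cells
`0, …, n - 1` hold the entries of `x`, and everything else is zero. -/
def RAMInput (n i : ℕ) (x : Fin n → ℕ) : RAMState where
  reg j := if j = 0 then n else if j = 1 then i else 0
  mem j := if h : j < n then x ⟨j, h⟩ else 0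

/-- A family of problems `f n : F^n × [m n] → F` is explicit if a single program computes
`f n x i` from `(n, i, x)` in time polynomial in `n`, leaving the answer in register `0`.  The
elements of the finite field are represented by the numbers below `|F|`. -/
def IsExplicit {F : Type*} [Fintype F] {m : ℕ → ℕ}
    (f : (n : ℕ) → (Fin n → F) → Fin (m n) → F) : Prop :=
  ∃ (e : F ≃ Fin (Fintype.card F)) (p : RAMProg) (P : Polynomial ℕ),
    ∀ (n : ℕ) (x : Fin n → F) (i : Fin (m n)), ∃ (T : ℕ) (τ : RAMState),
      RAMExec p (RAMInput n i (fun j => e (x j))) T τ ∧ T ≤ P.eval n ∧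
        τ.reg 0 = e (f n x i)

/-! ### The two lower bounds -/

/-- Query time `2` requires space `s ≥ m - Õ(m / n)`, where `Õ` hides factors polylogarithmic
in `n`. -/
def TwoProbeLowerBound {F : Type*} {m : ℕ → ℕ}
    (f : (n : ℕ) → (Fin n → F) → Fin (m n) → F) : Prop :=
  ∃ (C : ℝ) (a : ℕ), ∀ᶠ n : ℕ in atTop, ∀ s : ℕ, HasNonAdaptiveDS (f n) s 2 →
    (m n : ℝ) - C * ((m n : ℝ) / n * Real.logb 2 n ^ a) ≤ s

/-- Query time `t ≥ 3` requires space `s ≥ Ω(n (m/n)^{1/(t-1)} / (2^t log n log m))`, where the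
constant in `Ω` does not depend on `t`. -/
def MultiProbeLowerBound {F : Type*} {m : ℕ → ℕ}
    (f : (n : ℕ) → (Fin n → F) → Fin (m n) → F) : Prop :=
  ∃ c : ℝ, 0 < c ∧ ∀ᶠ n : ℕ in atTop, ∀ t : ℕ, 3 ≤ t → ∀ s : ℕ, HasNonAdaptiveDS (f n) s t →
    c * (n * ((m n : ℝ) / n) ^ (1 / ((t : ℝ) - 1)) *
      (1 / (2 ^ t * Real.logb 2 n * Real.logb 2 (m n)))) ≤ s

/-! Lower bounds. View cells as vertices and queries as hyperedges. The answers to at most `k`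
queries take all possible values and are determined by the probed cells, so such queries touch at
least as many cells as there are queries (`KWiseIndependent.card_le_card_biUnion`). It remains to
find few edges on even fewer vertices.

For `t = 2`, a graph with `(1 + 1/d)` times as many edges as vertices has such a subgraph with `O(d
log m)` edges (`exists_small_dense`): in a minimal vertex set of this density every set meets many
edges, so balls grow by a factor `1 + 1/d` until one contains two edges outside its search tree.
Taking `d` of order `k / log m` gives the bound. For `t ≥ 3`, select `r` popular cells `t - 2`
times, each time keeping an `r/s` fraction of the queries and removing one probe from each
(`exists_reduction_to_graph`). If more than a constant times `s` queries survive, disjoint small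
dense subgraphs yield an edge excess larger than the number of selected cells
(`exists_small_excess`), a contradiction.

Construction. Let `K` be a finite extension of `F` with an element `a` that is not a `q`-th power,
`q` an odd prime. Then `X ^ N - a` is irreducible for every power `N` of `q`, so a field `L` of
degree `N = Θ(log n)` over `K` is available without searching for an irreducible polynomial. The
columns of the matrix list the `F`-coordinates of the powers of distinct elements of `L`. By the
Vandermonde argument any `k = Θ(n / log n)` columns are independent (`eq_zero_of_codeEntry`), which
gives both distance and `k`-wise independence. Explicitness follows from closure of `PolyTime` under
arithmetic, table look-up and loops. -/

/-! ### Polynomially bounded functions -/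

/-- `g` is bounded by a polynomial in the size. -/
def PolyBdd {α : Type*} (size : α → ℕ) (g : α → ℕ) : Prop :=
  ∃ P : Polynomial ℕ, ∀ a, g a ≤ P.eval (size a)

theorem Polynomial.monotone_eval_nat (P : Polynomial ℕ) : Monotone fun x => P.eval x := by
  intro x y h
  simp only [Polynomial.eval_eq_sum_range]
  gcongr

namespace PolyBdd

variable {α : Type*} {size : α → ℕ} {f g : α → ℕ}

theorem mono (hg : PolyBdd size g) (h : ∀ a, f a ≤ g a) : PolyBdd size f :=
  let ⟨P, hP⟩ := hg
  ⟨P, fun a => (h a).trans (hP a)⟩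

theorem const (c : ℕ) : PolyBdd size fun _ => c :=
  ⟨Polynomial.C c, fun _ => by simp⟩

theorem self : PolyBdd size size :=
  ⟨Polynomial.X, fun _ => by simp⟩

theorem add (hf : PolyBdd size f) (hg : PolyBdd size g) : PolyBdd size fun a => f a + g a :=
  let ⟨P, hP⟩ := hf
  let ⟨Q, hQ⟩ := hg
  ⟨P + Q, fun a => by simpa using Nat.add_le_add (hP a) (hQ a)⟩

theorem mul (hf : PolyBdd size f) (hg : PolyBdd size g) : PolyBdd size fun a => f a * g a :=
  let ⟨P, hP⟩ := hf
  let ⟨Q, hQ⟩ := hg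
  ⟨P * Q, fun a => by simpa using Nat.mul_le_mul (hP a) (hQ a)⟩

theorem pow (hf : PolyBdd size f) (c : ℕ) : PolyBdd size fun a => f a ^ c :=
  let ⟨P, hP⟩ := hf
  ⟨P ^ c, fun a => by simpa using Nat.pow_le_pow_left (hP a) c⟩

theorem lift (hf : PolyBdd size f) :
    PolyBdd (fun p : α × ℕ => size p.1 + p.2) fun p => f p.1 :=
  let ⟨P, hP⟩ := hf
  ⟨P, fun p => (hP p.1).trans (P.monotone_eval_nat (Nat.le_add_right _ _))⟩

theorem index : PolyBdd (fun p : α × ℕ => size p.1 + p.2) fun p => p.2 :=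
  self.mono fun _ => Nat.le_add_left _ _

/-- Bounds the cost of a loop body independently of the iteration, since the index stays below a
polynomial. -/
theorem uniform {h : α × ℕ → ℕ} (hh : PolyBdd (fun p : α × ℕ => size p.1 + p.2) h)
    (hf : PolyBdd size f) :
    ∃ g, PolyBdd size g ∧ ∀ a t, t < f a → h (a, t) ≤ g a := by
  obtain ⟨P, hP⟩ := hh
  obtain ⟨Q, hQ⟩ := hf
  refine ⟨fun a => P.eval (size a + Q.eval (size a)),
    ⟨P.comp (Polynomial.X + Q), fun a => by simp⟩, fun a t ht => (hP _).trans ?_⟩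
  exact P.monotone_eval_nat (by simpa using (ht.le.trans (hQ a)))

end PolyBdd

/-! ### Functions computed in polynomial time with read-only memory -/

/-- `PolyTime mem size Γ f`: whenever the memory holds `mem a` and the values `g a` of the functions
`g ∈ Γ` are in registers below `b`, some program computes `f a` into register `b` in time polynomial
in `size a`, leaving the memory and the registers below `b` unchanged. -/
def PolyTime {α : Type*} (mem : α → ℕ → ℕ) (size : α → ℕ) (Γ : Set (α → ℕ)) (f : α → ℕ) : Prop :=
  ∀ (v : (α → ℕ) → ℕ) (b : ℕ), (∀ g ∈ Γ, v g < b) →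
    ∃ (p : RAMProg) (B : α → ℕ), PolyBdd size B ∧ ∀ (a : α) (σ : RAMState), σ.mem = mem a →
      (∀ g ∈ Γ, σ.reg (v g) = g a) →
      ∃ (T : ℕ) (τ : RAMState), RAMExec p σ T τ ∧ T ≤ B a ∧
        (∀ j < b, τ.reg j = σ.reg j) ∧ τ.mem = σ.mem ∧ τ.reg b = f a

/-- The context inside a loop: the variables of `Γ` and the loop index. -/
def loopCtx {α : Type*} (Γ : Set (α → ℕ)) : Set (α × ℕ → ℕ) :=
  insert Prod.snd ((fun g p => g p.1) '' Γ)

namespace PolyTime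

variable {α : Type*} {mem : α → ℕ → ℕ} {size : α → ℕ} {Γ : Set (α → ℕ)} {f g h : α → ℕ}

theorem mono {Δ : Set (α → ℕ)} (hf : PolyTime mem size Γ f) (hΓ : Γ ⊆ Δ) :
    PolyTime mem size Δ f := by
  intro v b hv
  obtain ⟨p, B, hB, hp⟩ := hf v b fun g hg => hv g (hΓ hg)
  exact ⟨p, B, hB, fun a σ hσ hreg => hp a σ hσ fun g hg => hreg g (hΓ hg)⟩

theorem lift (hf : PolyTime mem size Γ f) :
    PolyTime (fun p : α × ℕ => mem p.1) (fun p => size p.1 + p.2) (loopCtx Γ) fun p => f p.1 := by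
  intro v b hv
  obtain ⟨p, B, hB, hp⟩ := hf (fun g => v fun p => g p.1) b
    fun g hg => hv _ (Or.inr ⟨g, hg, rfl⟩)
  exact ⟨p, _, hB.lift, fun a σ hσ hreg => hp a.1 σ hσ fun g hg => hreg _ (Or.inr ⟨g, hg, rfl⟩)⟩

theorem const (c : ℕ) : PolyTime mem size Γ fun _ => c := by
  intro v b hv
  refine ⟨.const b c, _, .const 1, fun a σ _ _ => ⟨_, _, .const _ _ _, le_rfl, ?_, rfl, ?_⟩⟩
  · intro j hj
    simp [hj.ne]
  · simp

theorem var (hf : f ∈ Γ) : PolyTime mem size Γ f := by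
  intro v b hv
  -- There is no copy instruction; a register is copied by adding zero.
  refine ⟨.seq (.const b 0) (.add b (v f) b), _, .const 2, fun a σ _ hreg =>
    ⟨_, _, .seq (.const _ _ _) (.add _ _ _ _), le_rfl, ?_, rfl, ?_⟩⟩
  · intro j hj
    simp [hj.ne]
  · simp [(hv f hf).ne, hreg f hf]

theorem index :
    PolyTime (fun p : α × ℕ => mem p.1) (fun p => size p.1 + p.2) (loopCtx Γ) fun p => p.2 :=
  var (Or.inl rfl)

theorem load (hf : PolyTime mem size Γ f) : PolyTime mem size Γ fun a => mem a (f a) := by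
  intro v b hv
  obtain ⟨p, B, hB, hp⟩ := hf v b hv
  refine ⟨.seq p (.load b b), _, hB.add (.const 1), fun a σ hσ hreg => ?_⟩
  obtain ⟨T, τ, hT, hTB, hj, hm, hr⟩ := hp a σ hσ hreg
  refine ⟨_, _, .seq hT (.load _ _ _), by simpa using hTB, ?_, hm, ?_⟩
  · intro j hjb
    simp [hjb.ne, hj j hjb]
  · simp [hm, hr, hσ]

/-- Running two computations one after the other, with results in registers `b` and `b + 1`. -/
theorem pair (hf : PolyTime mem size Γ f) (hg : PolyTime mem size Γ g)
    (v : (α → ℕ) → ℕ) (b : ℕ) (hv : ∀ g ∈ Γ, v g < b) :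
    ∃ (p : RAMProg) (B : α → ℕ), PolyBdd size B ∧ ∀ (a : α) (σ : RAMState), σ.mem = mem a →
      (∀ g ∈ Γ, σ.reg (v g) = g a) →
      ∃ (T : ℕ) (τ : RAMState), RAMExec p σ T τ ∧ T ≤ B a ∧
        (∀ j < b, τ.reg j = σ.reg j) ∧ τ.mem = σ.mem ∧ τ.reg b = f a ∧ τ.reg (b + 1) = g a := by
  obtain ⟨p, B, hB, hp⟩ := hf v b hv
  obtain ⟨q, C, hC, hq⟩ := hg v (b + 1) fun g hg => (hv g hg).trans (Nat.lt_succ_self b)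
  refine ⟨.seq p q, _, hB.add hC, fun a σ hσ hreg => ?_⟩
  obtain ⟨T, τ, hT, hTB, hj, hm, hr⟩ := hp a σ hσ hreg
  obtain ⟨T', τ', hT', hTB', hj', hm', hr'⟩ := hq a τ (hm.trans hσ)
    fun g hg => (hj _ (hv g hg)).trans (hreg g hg)
  exact ⟨_, _, .seq hT hT', Nat.add_le_add hTB hTB',
    fun j h => (hj' j (h.trans (Nat.lt_succ_self b))).trans (hj j h), hm'.trans hm,
    (hj' b (Nat.lt_succ_self b)).trans hr, hr'⟩

theorem add (hf : PolyTime mem size Γ f) (hg : PolyTime mem size Γ g) :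
    PolyTime mem size Γ fun a => f a + g a := by
  intro v b hv
  obtain ⟨p, B, hB, hp⟩ := hf.pair hg v b hv
  refine ⟨.seq p (.add b b (b + 1)), _, hB.add (.const 1), fun a σ hσ hreg => ?_⟩
  obtain ⟨T, τ, hT, hTB, hj, hm, hr, hr'⟩ := hp a σ hσ hreg
  refine ⟨_, _, .seq hT (.add _ _ _ _), by simpa using hTB, ?_, hm, ?_⟩
  · intro j hjb
    simp [hjb.ne, hj j hjb]
  · simp [hr, hr']

theorem sub (hf : PolyTime mem size Γ f) (hg : PolyTime mem size Γ g) :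
    PolyTime mem size Γ fun a => f a - g a := by
  intro v b hv
  obtain ⟨p, B, hB, hp⟩ := hf.pair hg v b hv
  refine ⟨.seq p (.sub b b (b + 1)), _, hB.add (.const 1), fun a σ hσ hreg => ?_⟩
  obtain ⟨T, τ, hT, hTB, hj, hm, hr, hr'⟩ := hp a σ hσ hreg
  refine ⟨_, _, .seq hT (.sub _ _ _ _), by simpa using hTB, ?_, hm, ?_⟩
  · intro j hjb
    simp [hjb.ne, hj j hjb]
  · simp [hr, hr']

theorem ite_eq_zero (hf : PolyTime mem size Γ f) (hg : PolyTime mem size Γ g)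
    (hh : PolyTime mem size Γ h) :
    PolyTime mem size Γ fun a => if f a = 0 then g a else h a := by
  intro v b hv
  obtain ⟨p, B, hB, hp⟩ := hf v b hv
  obtain ⟨q, C, hC, hq⟩ := hg v b hv
  obtain ⟨r, D, hD, hr⟩ := hh v b hv
  refine ⟨.seq p (.ite b r q), _, hB.add ((hC.add hD).add (.const 1)), fun a σ hσ hreg => ?_⟩
  obtain ⟨T, τ, hT, hTB, hj, hm, hb⟩ := hp a σ hσ hreg
  have hreg' : ∀ g ∈ Γ, τ.reg (v g) = g a := fun g hg => (hj _ (hv g hg)).trans (hreg g hg)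
  by_cases h0 : f a = 0
  · obtain ⟨T', τ', hT', hTB', hj', hm', hb'⟩ := hq a τ (hm.trans hσ) hreg'
    refine ⟨_, _, .seq hT (.iteFalse (hb.trans h0) hT'), by omega,
      fun j h => (hj' j h).trans (hj j h), hm'.trans hm, by simp [h0, hb']⟩
  · obtain ⟨T', τ', hT', hTB', hj', hm', hb'⟩ := hr a τ (hm.trans hσ) hreg'
    refine ⟨_, _, .seq hT (.iteTrue (by rwa [hb]) hT'), by omega,
      fun j h => (hj' j h).trans (hj j h), hm'.trans hm, by simp [h0, hb']⟩

/-- A `for` loop with an accumulator. -/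
theorem loop {acc : α × ℕ → ℕ} {cnt : α → ℕ}
    (hinit : PolyTime mem size Γ fun a => acc (a, 0)) (hcnt : PolyTime mem size Γ cnt)
    (hbdd : PolyBdd size cnt)
    (hstep : PolyTime (fun p : α × ℕ => mem p.1) (fun p => size p.1 + p.2)
      (insert acc (loopCtx Γ)) fun p => acc (p.1, p.2 + 1)) :
    PolyTime mem size Γ fun a => acc (a, cnt a) := by
  classical
  intro v b hv
  obtain ⟨p, B, hB, hp⟩ := hinit.pair hcnt v b hv
  -- Register layout: accumulator in `b`, remaining iterations in `b + 1`, loop index in `b + 2`,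
  -- the constant 1 in `b + 3`; the body computes from `b + 4` on.
  let w : (α × ℕ → ℕ) → ℕ := fun g => if g = acc then b else if g = Prod.snd then b + 2 else
    if h : ∃ g' ∈ Γ, (fun p : α × ℕ => g' p.1) = g then v h.choose else 0
  have hw : ∀ g ∈ insert acc (loopCtx Γ), g = acc ∧ w g = b ∨ g = Prod.snd ∧ w g = b + 2 ∨
      ∃ g' ∈ Γ, (fun p : α × ℕ => g' p.1) = g ∧ w g = v g' := by
    intro g hg
    by_cases h1 : g = acc
    · exact Or.inl ⟨h1, by simp [w, h1]⟩
    by_cases h2 : g = Prod.snd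
    · exact Or.inr (Or.inl ⟨h2, by simp only [w, if_neg h1, if_pos h2]⟩)
    · have h3 : ∃ g' ∈ Γ, (fun p : α × ℕ => g' p.1) = g := by
        simpa [loopCtx, h1, h2] using hg
      exact Or.inr (Or.inr ⟨h3.choose, h3.choose_spec.1, h3.choose_spec.2,
        by simp only [w, if_neg h1, if_neg h2, dif_pos h3]⟩)
  obtain ⟨q, C, hC, hq⟩ := hstep w (b + 4) (by
    intro g hg
    rcases hw g hg with ⟨-, h⟩ | ⟨-, h⟩ | ⟨g', hg', -, h⟩
    · omega
    · omega
    · have := hv g' hg'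
      omega)
  obtain ⟨D, hD, hCD⟩ := hC.uniform hbdd
  let body : RAMProg := .seq q (.seq (.const (b + 5) 0) (.seq (.add b (b + 4) (b + 5))
    (.seq (.add (b + 2) (b + 2) (b + 3)) (.sub (b + 1) (b + 1) (b + 3)))))
  have key : ∀ (a : α) (r t : ℕ) (σ : RAMState), t + r = cnt a → σ.mem = mem a →
      (∀ g ∈ Γ, σ.reg (v g) = g a) → σ.reg b = acc (a, t) → σ.reg (b + 1) = r →
      σ.reg (b + 2) = t → σ.reg (b + 3) = 1 →
      -- Each round costs the step program, four bookkeeping instructions and one test; the last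
      -- summand is the final test.
      ∃ (T : ℕ) (τ : RAMState), RAMExec (.loop (b + 1) body) σ T τ ∧ T ≤ r * (D a + 5) + 1 ∧
        (∀ j < b, τ.reg j = σ.reg j) ∧ τ.mem = σ.mem ∧ τ.reg b = acc (a, cnt a) := by
    intro a r
    induction r with
    | zero =>
      intro t σ ht _ _ h0 h1 _ _
      exact ⟨_, _, .loopDone h1, by omega, fun _ _ => rfl, rfl, by rw [h0, ← ht, Nat.add_zero]⟩
    | succ r ih =>
      intro t σ ht hσ hreg h0 h1 h2 h3
      obtain ⟨T, τ, hT, hTB, hj, hm, hr⟩ := hq (a, t) σ hσ (by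
        intro g hg
        rcases hw g hg with ⟨h, h'⟩ | ⟨h, h'⟩ | ⟨g', hg', h, h'⟩
        · rw [h', h, h0]
        · rw [h', h, h2]
        · rw [h', ← h]
          exact hreg g' hg')
      have hD' := hCD a t (by omega)
      have e1 := hj (b + 1) (by omega)
      have e2 := hj (b + 2) (by omega)
      have e3 := hj (b + 3) (by omega)
      obtain ⟨σ', hbody, hm', hlow, f0, f1, f2, f3⟩ : ∃ σ', RAMExec body σ (T + 4) σ' ∧
          σ'.mem = σ.mem ∧ (∀ j < b, σ'.reg j = σ.reg j) ∧ σ'.reg b = acc (a, t + 1) ∧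
          σ'.reg (b + 1) = r ∧ σ'.reg (b + 2) = t + 1 ∧ σ'.reg (b + 3) = 1 := by
        refine ⟨_, .seq hT (.seq (.const _ _ _) (.seq (.add _ _ _ _) (.seq (.add _ _ _ _)
          (.sub _ _ _ _)))), hm, ?_, ?_, ?_, ?_, ?_⟩
        · intro j h
          have n0 : j ≠ b := by omega
          have n1 : j ≠ b + 1 := by omega
          have n2 : j ≠ b + 2 := by omega
          have n5 : j ≠ b + 5 := by omega
          simp [n0, n1, n2, n5, hj j (by omega)]
        · simp [hr]
        · simp [e1, e3, h1, h3]
        · simp [e2, e3, h2, h3]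
        · simp [e3, h3]
      obtain ⟨T', τ', hT', hTB', hj', hm'', hr'⟩ := ih (t + 1) σ' (by omega) (hm'.trans hσ)
        (fun g hg => (hlow _ (hv g hg)).trans (hreg g hg)) f0 f1 f2 f3
      refine ⟨_, _, .loopStep (by omega) hbody hT', ?_, fun j h => (hj' j h).trans (hlow j h),
        hm''.trans hm', hr'⟩
      have : (r + 1) * (D a + 5) = r * (D a + 5) + (D a + 5) := by ring
      omega
  refine ⟨.seq p (.seq (.const (b + 2) 0) (.seq (.const (b + 3) 1) (.loop (b + 1) body))),
    fun a => B a + (cnt a * (D a + 5) + 3),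
    hB.add ((hbdd.mul (hD.add (.const 5))).add (.const 3)), fun a σ hσ hreg => ?_⟩
  obtain ⟨T, τ, hT, hTB, hj, hm, hr, hr'⟩ := hp a σ hσ hreg
  obtain ⟨T', τ', hT', hTB', hj', hm', hb'⟩ := key a (cnt a) 0
    ⟨Function.update (Function.update τ.reg (b + 2) 0) (b + 3) 1, τ.mem⟩ (by simp) (hm.trans hσ)
    (by
      intro g hg
      have h := hv g hg
      have n2 : v g ≠ b + 2 := by omega
      have n3 : v g ≠ b + 3 := by omega
      simp [n2, n3, hj _ h, hreg g hg])
    (by simp [hr]) (by simp [hr']) (by simp) (by simp)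
  refine ⟨_, _, .seq hT (.seq (.const _ _ _) (.seq (.const _ _ _) hT')), by dsimp only; omega, ?_,
    hm'.trans hm, hb'⟩
  intro j h
  have n2 : j ≠ b + 2 := by omega
  have n3 : j ≠ b + 3 := by omega
  rw [hj' j h]
  simp [n2, n3, hj j h]

end PolyTime

/-- Recovers a number by counting the thresholds up to it; quotients and logarithms are computed by
such a count. -/
theorem Finset.sum_range_ite_succ_le {x y : ℕ} (h : y ≤ x) :
    ∑ t ∈ Finset.range x, (if t + 1 ≤ y then 1 else 0) = y := by
  have : (Finset.range x).filter (fun t => t + 1 ≤ y) = Finset.range y := by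
    ext t
    simp only [Finset.mem_filter, Finset.mem_range]
    omega
  rw [← Finset.sum_filter, this]
  simp

/-! ### Arithmetic, table look-up and sums in polynomial time -/

namespace PolyTime

variable {α : Type*} {mem : α → ℕ → ℕ} {size : α → ℕ} {Γ : Set (α → ℕ)} {f g h : α → ℕ}

theorem ite_le {u : α → ℕ} (hf : PolyTime mem size Γ f) (hg : PolyTime mem size Γ g)
    (hh : PolyTime mem size Γ h) (hu : PolyTime mem size Γ u) :
    PolyTime mem size Γ fun a => if f a ≤ g a then h a else u a := by
  simpa only [Nat.sub_eq_zero_iff_le] using (hf.sub hg).ite_eq_zero hh hu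

theorem sum {h : α × ℕ → ℕ}
    (hh : PolyTime (fun p : α × ℕ => mem p.1) (fun p => size p.1 + p.2) (loopCtx Γ) h)
    (hf : PolyTime mem size Γ f) (hb : PolyBdd size f) :
    PolyTime mem size Γ fun a => ∑ t ∈ Finset.range (f a), h (a, t) := by
  refine loop (acc := fun p => ∑ t ∈ Finset.range p.2, h (p.1, t)) (by simpa using const 0) hf hb ?_
  simp only [Finset.sum_range_succ]
  exact (var (Set.mem_insert _ _)).add (hh.mono (Set.subset_insert _ _))

/-- Repeated addition of `f a`, so only the number `g a` of rounds needs a polynomial bound. -/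
theorem mul (hf : PolyTime mem size Γ f) (hg : PolyTime mem size Γ g) (hb : PolyBdd size g) :
    PolyTime mem size Γ fun a => f a * g a := by
  simpa [mul_comm] using hf.lift.sum hg hb

theorem div (hf : PolyTime mem size Γ f) (hb : PolyBdd size f) (hg : PolyTime mem size Γ g)
    (h0 : ∀ a, 0 < g a) : PolyTime mem size Γ fun a => f a / g a := by
  have := sum (h := fun p => if g p.1 * (p.2 + 1) ≤ f p.1 then 1 else 0)
    (ite_le (hg.lift.mul (index.add (const 1)) (PolyBdd.index.add (.const 1))) hf.lift (const 1)
      (const 0)) hf hb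
  convert this using 2 with a
  simp only [mul_comm (g a), ← Nat.le_div_iff_mul_le (h0 a)]
  exact (Finset.sum_range_ite_succ_le (Nat.div_le_self _ _)).symm

theorem mod (hf : PolyTime mem size Γ f) (hb : PolyBdd size f) (hg : PolyTime mem size Γ g)
    (h0 : ∀ a, 0 < g a) : PolyTime mem size Γ fun a => f a % g a := by
  simp only [Nat.mod_eq_sub_mul_div]
  exact hf.sub (hg.mul (hf.div hb hg h0) (hb.mono fun a => Nat.div_le_self _ _))

theorem const_pow (c : ℕ) (hf : PolyTime mem size Γ f) (hb : PolyBdd size f) :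
    PolyTime mem size Γ fun a => c ^ f a := by
  refine loop (acc := fun p : α × ℕ => c ^ p.2) (by simpa using const 1) hf hb ?_
  simp only [pow_succ]
  exact (var (Set.mem_insert _ _)).mul (const c) (.const c)

theorem log {c : ℕ} (hc : 1 < c) (hf : PolyTime mem size Γ f) (hb : PolyBdd size f) :
    PolyTime mem size Γ fun a => Nat.log c (f a) := by
  have := sum (h := fun p => if c ^ (p.2 + 1) ≤ f p.1 then 1 else 0)
    (ite_le (const_pow c (index.add (const 1)) (PolyBdd.index.add (.const 1))) hf.lift (const 1)
      (const 0)) hf hb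
  convert this using 2 with a
  rcases Nat.eq_zero_or_pos (f a) with h0 | h0
  · simp [h0]
  simp only [← Nat.le_log_iff_pow_le hc h0.ne']
  exact (Finset.sum_range_ite_succ_le (Nat.log_le_self _ _)).symm

/-- A function of boundedly many values can be looked up in a table. -/
theorem table (φ : ℕ → ℕ) {Q : ℕ} (hf : PolyTime mem size Γ f) (hQ : ∀ a, f a < Q) :
    PolyTime mem size Γ fun a => φ (f a) := by
  have key : ∀ Q : ℕ, PolyTime mem size Γ fun a => if f a + 1 ≤ Q then φ (f a) else 0 := by
    intro Q
    induction Q with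
    | zero => simpa using const 0
    | succ Q ih =>
      have := ite_le (hf.add (const 1)) (const Q) ih
        (ite_le hf (const Q) (const (φ Q)) (const 0))
      convert this using 2 with a
      by_cases h1 : f a + 1 ≤ Q
      · simp [h1, h1.trans (Nat.le_succ Q)]
      · by_cases h2 : f a ≤ Q
        · have h3 : f a = Q := by omega
          simp [h3]
        · rw [if_neg h1, if_neg h2, if_neg (by omega)]
  simpa [Nat.succ_le_iff, hQ] using key Q

/-- Functions on finite types, with elements represented by numbers, can be looked up. -/
theorem map₂ {A B C : Type*} {p q : ℕ} {eA : A ≃ Fin p} {eB : B ≃ Fin q} (eC : C → ℕ)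
    (φ : A → B → C) {x : α → A} {y : α → B} (hx : PolyTime mem size Γ fun a => eA (x a))
    (hy : PolyTime mem size Γ fun a => eB (y a)) :
    PolyTime mem size Γ fun a => eC (φ (x a) (y a)) := by
  let ψ : ℕ → ℕ := fun z => if h : z % p < p ∧ z / p < q then
    eC (φ (eA.symm ⟨z % p, h.1⟩) (eB.symm ⟨z / p, h.2⟩)) else 0
  -- The pair of codes is packed into one number below `p * q`, so that a single table suffices.
  have := (hx.add (hy.mul (const p) (.const p))).table (Q := p * q) ψ (by
    intro a
    nlinarith [(eA (x a)).2, (eB (y a)).2])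
  convert this using 2 with a
  have hp : 0 < p := (Nat.zero_le _).trans_lt (eA (x a)).2
  have h1 : ((eA (x a) : ℕ) + eB (y a) * p) % p = eA (x a) := by
    rw [Nat.add_mul_mod_self_right, Nat.mod_eq_of_lt (eA (x a)).2]
  have h2 : ((eA (x a) : ℕ) + eB (y a) * p) / p = eB (y a) := by
    rw [Nat.add_mul_div_right _ _ hp, Nat.div_eq_of_lt (eA (x a)).2, zero_add]
  simp [ψ, h1, h2]

/-- Sums over a finite commutative monoid. -/
theorem sum_monoid {A : Type*} [AddCommMonoid A] {p : ℕ} {eA : A ≃ Fin p} {x : α × ℕ → A}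
    (hx : PolyTime (fun p : α × ℕ => mem p.1) (fun p => size p.1 + p.2) (loopCtx Γ)
      fun p => eA (x p))
    (hf : PolyTime mem size Γ f) (hb : PolyBdd size f) :
    PolyTime mem size Γ fun a => eA (∑ t ∈ Finset.range (f a), x (a, t)) := by
  refine loop (acc := fun p => (eA (∑ t ∈ Finset.range p.2, x (p.1, t)) : ℕ))
    (by simpa using const _) hf hb ?_
  simp only [Finset.sum_range_succ]
  exact map₂ (fun z => (eA z : ℕ)) (· + ·) (var (Set.mem_insert _ _))
    (hx.mono (Set.subset_insert _ _))

end PolyTime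

/-! ### Small dense subgraphs

Queries are edges `e i` of a hypergraph whose vertices are the memory cells. -/

section Hypergraph

variable {ι V : Type*} [DecidableEq V]

/-- The ball of radius `j` around `v` in the hypergraph with edges `e i`, `i ∈ E`. -/
def hyperBall (e : ι → Finset V) (E : Finset ι) (v : V) : ℕ → Finset V
  | 0 => {v}
  | j + 1 => hyperBall e E v j ∪ (E.filter fun i => ¬Disjoint (e i) (hyperBall e E v j)).biUnion e

theorem hyperBall_subset_succ (e : ι → Finset V) (E : Finset ι) (v : V) (j : ℕ) :
    hyperBall e E v j ⊆ hyperBall e E v (j + 1) :=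
  Finset.subset_union_left

theorem hyperBall_mono (e : ι → Finset V) (E : Finset ι) (v : V) : Monotone (hyperBall e E v) :=
  monotone_nat_of_le_succ (hyperBall_subset_succ e E v)

theorem mem_hyperBall (e : ι → Finset V) (E : Finset ι) (v : V) (j : ℕ) :
    v ∈ hyperBall e E v j :=
  hyperBall_mono e E v (Nat.zero_le j) (by simp [hyperBall])

theorem hyperBall_subset {e : ι → Finset V} {E : Finset ι} {v : V} {U : Finset V} (hv : v ∈ U)
    (hU : ∀ i ∈ E, e i ⊆ U) (j : ℕ) : hyperBall e E v j ⊆ U := by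
  induction j with
  | zero => simpa [hyperBall] using hv
  | succ j ih =>
    refine Finset.union_subset ih (Finset.biUnion_subset.2 fun i hi => hU i ?_)
    exact (Finset.mem_filter.1 hi).1

/-- Every vertex of a ball other than the centre has an edge to a vertex closer to the centre. -/
theorem exists_parent {e : ι → Finset V} {E : Finset ι} (he : ∀ i ∈ E, (e i).card ≤ 2) {v : V}
    {j : ℕ} {u : V} (hu : u ∈ hyperBall e E v j) (huv : u ≠ v) :
    ∃ i ∈ E, ∃ w ∈ hyperBall e E v j, e i = {u, w} ∧
      sInf {l | w ∈ hyperBall e E v l} < sInf {l | u ∈ hyperBall e E v l} := by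
  have hne : {l | u ∈ hyperBall e E v l}.Nonempty := ⟨j, hu⟩
  have hmem := Nat.sInf_mem hne
  have hle : sInf {l | u ∈ hyperBall e E v l} ≤ j := Nat.sInf_le hu
  have hnot : ∀ l < sInf {l | u ∈ hyperBall e E v l}, u ∉ hyperBall e E v l :=
    fun l hl => Nat.notMem_of_lt_sInf hl
  generalize sInf {l | u ∈ hyperBall e E v l} = D at *
  cases D with
  | zero =>
    refine absurd ?_ huv
    simpa [hyperBall] using hmem
  | succ D =>
    have hD := hnot D (Nat.lt_succ_self D)
    rcases Finset.mem_union.1 hmem with h | h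
    · exact absurd h hD
    obtain ⟨i, hi, hui⟩ := Finset.mem_biUnion.1 h
    obtain ⟨hiE, hdis⟩ := Finset.mem_filter.1 hi
    obtain ⟨w, hwi, hwB⟩ := Finset.not_disjoint_iff.1 hdis
    have huw : u ≠ w := fun h => hD (h ▸ hwB)
    refine ⟨i, hiE, w, hyperBall_mono e E v (by omega) hwB, ?_, ?_⟩
    · refine (Finset.eq_of_subset_of_card_le ?_ ?_).symm
      · simp [Finset.insert_subset_iff, hui, hwi]
      · rw [Finset.card_pair huw]
        exact he i hiE
    · exact Nat.lt_succ_of_le (Nat.sInf_le hwB)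

/-- A ball with more edges than vertices contains a small subgraph with more edges than vertices:
two edges outside a breadth-first search tree and the paths from their ends to the root. -/
theorem exists_dense_of_hyperBall {e : ι → Finset V} {E : Finset ι} (he : ∀ i ∈ E, (e i).card ≤ 2)
    {v : V} {j : ℕ}
    (hB : (hyperBall e E v j).card < (E.filter fun i => e i ⊆ hyperBall e E v j).card) :
    ∃ S ⊆ E, (S.biUnion e).card < S.card ∧ S.card ≤ 4 * j + 6 := by
  classical
  set B := hyperBall e E v j with hBdef
  have hvB : v ∈ B := mem_hyperBall e E v j
  have : Nonempty ι := by
    obtain ⟨i, -⟩ := Finset.card_pos.1 ((Nat.zero_le _).trans_lt hB)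
    exact ⟨i⟩
  have : Nonempty V := ⟨v⟩
  have hpar : ∀ u, u ∈ B ∧ u ≠ v → ∃ i w, i ∈ E ∧ w ∈ B ∧ e i = {u, w} ∧
      sInf {l | w ∈ hyperBall e E v l} < sInf {l | u ∈ hyperBall e E v l} := by
    rintro u ⟨hu, huv⟩
    obtain ⟨i, hi, w, hw, h⟩ := exists_parent he hu huv
    exact ⟨i, w, hi, hw, h⟩
  choose! pe par hpeE hparB hpe hdep using hpar
  -- Two vertices sharing a parent edge would be each other's parents, but parents are strictly
  -- closer to the root.
  have hinj : ∀ u u', u ∈ B ∧ u ≠ v → u' ∈ B ∧ u' ≠ v → pe u = pe u' → u = u' := by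
    intro u u' hu hu' h
    by_contra hne
    have h1 := hpe u hu
    have h2 := hpe u' hu'
    rw [h, h2] at h1
    have hu'mem : u' ∈ ({u, par u} : Finset V) := h1 ▸ Finset.mem_insert_self _ _
    have humem : u ∈ ({u', par u'} : Finset V) := h1.symm ▸ Finset.mem_insert_self _ _
    have e1 : u' = par u := by
      rcases Finset.mem_insert.1 hu'mem with h | h
      · exact absurd h.symm hne
      · exact Finset.mem_singleton.1 h
    have e2 : u = par u' := by
      rcases Finset.mem_insert.1 humem with h | h
      · exact absurd h hne
      · exact Finset.mem_singleton.1 h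
    have d1 := hdep u hu
    have d2 := hdep u' hu'
    rw [← e1] at d1
    rw [← e2] at d2
    exact lt_asymm d1 d2
  -- The path from `u` to the root, as a set closed under `par`.
  have hanc : ∀ l, ∀ u ∈ B, sInf {l | u ∈ hyperBall e E v l} ≤ l → ∃ W ⊆ B, u ∈ W ∧ v ∈ W ∧
      W.card ≤ l + 1 ∧ ∀ w ∈ W, w ≠ v → par w ∈ W := by
    intro l
    induction l with
    | zero =>
      intro u hu hl
      have hmem := Nat.sInf_mem (s := {l | u ∈ hyperBall e E v l}) ⟨j, hu⟩
      rw [Nat.le_zero.1 hl] at hmem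
      have huv : u = v := by simpa [hyperBall] using hmem
      exact ⟨{v}, by simpa using hvB, by simp [huv], by simp, by simp, by simp⟩
    | succ l ih =>
      intro u hu hl
      by_cases huv : u = v
      · exact ⟨{v}, by simpa using hvB, by simp [huv], by simp, by simp, by simp⟩
      have hd := hdep u ⟨hu, huv⟩
      obtain ⟨W, hWB, huW, hvW, hcard, hcl⟩ := ih (par u) (hparB u ⟨hu, huv⟩) (by omega)
      refine ⟨insert u W, Finset.insert_subset hu hWB, by simp, by simp [hvW], ?_, ?_⟩
      · exact (Finset.card_insert_le _ _).trans (by omega)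
      · intro w hw hwv
        rcases Finset.mem_insert.1 hw with rfl | hw
        · exact Finset.mem_insert_of_mem huW
        · exact Finset.mem_insert_of_mem (hcl w hw hwv)
  have hanc' : ∀ u, u ∈ B → ∃ W ⊆ B, u ∈ W ∧ v ∈ W ∧ W.card ≤ j + 1 ∧
      ∀ w ∈ W, w ≠ v → par w ∈ W := fun u hu => hanc j u hu (Nat.sInf_le hu)
  choose! Wf hWB hWself hWv hWcard hWcl using hanc'
  have hT : ((B.erase v).image pe).card ≤ B.card - 1 :=
    Finset.card_image_le.trans (Finset.card_erase_of_mem hvB).le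
  -- The search tree has at most `|B| - 1` edges, so at least two edges of the ball lie outside it.
  have hX : 1 < ((E.filter fun i => e i ⊆ B) \ (B.erase v).image pe).card := by
    have := Finset.le_card_sdiff ((B.erase v).image pe) (E.filter fun i => e i ⊆ B)
    have := Finset.card_pos.2 ⟨v, hvB⟩
    omega
  obtain ⟨a, ha, b, hb, hab⟩ := Finset.one_lt_card.1 hX
  simp only [Finset.mem_sdiff, Finset.mem_filter] at ha hb
  obtain ⟨⟨haE, haB⟩, haT⟩ := ha
  obtain ⟨⟨hbE, hbB⟩, hbT⟩ := hb
  set W := insert v ((e a ∪ e b).biUnion Wf) with hW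
  have habB : e a ∪ e b ⊆ B := Finset.union_subset haB hbB
  have hWsub : W ⊆ B := Finset.insert_subset hvB
    (Finset.biUnion_subset.2 fun u hu => hWB u (habB hu))
  -- Four ends, each with a path of at most `j + 1` vertices, and the root.
  have hWc : W.card ≤ 4 * j + 5 := by
    have h1 : ((e a ∪ e b).biUnion Wf).card ≤ (e a ∪ e b).card * (j + 1) :=
      Finset.card_biUnion_le_card_mul _ _ _ fun u hu => hWcard u (habB hu)
    have h2 : (e a ∪ e b).card ≤ 4 :=
      (Finset.card_union_le _ _).trans (by have := he a haE; have := he b hbE; omega)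
    have h3 : W.card ≤ _ := Finset.card_insert_le v ((e a ∪ e b).biUnion Wf)
    have h4 := Nat.mul_le_mul_right (j + 1) h2
    omega
  have hWclosed : ∀ w ∈ W, w ≠ v → par w ∈ W := by
    intro w hw hwv
    rcases Finset.mem_insert.1 hw with h | h
    · exact absurd h hwv
    · obtain ⟨u, hu, hwu⟩ := Finset.mem_biUnion.1 h
      exact Finset.mem_insert_of_mem
        (Finset.mem_biUnion.2 ⟨u, hu, hWcl u (habB hu) w hwu hwv⟩)
  have hvW : v ∈ W := Finset.mem_insert_self _ _
  have hpeW : ((W.erase v).image pe).card = W.card - 1 := by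
    rw [Finset.card_image_of_injOn, Finset.card_erase_of_mem hvW]
    intro u hu u' hu' h
    have hu := Finset.mem_erase.1 hu
    have hu' := Finset.mem_erase.1 hu'
    exact hinj u u' ⟨hWsub hu.2, hu.1⟩ ⟨hWsub hu'.2, hu'.1⟩ h
  have hsubT : (W.erase v).image pe ⊆ (B.erase v).image pe :=
    Finset.image_subset_image (Finset.erase_subset_erase _ hWsub)
  -- The `|W| - 1` parent edges together with `a` and `b` are `|W| + 1` edges inside `W`.
  have hScard : (insert a (insert b ((W.erase v).image pe))).card = W.card + 1 := by
    have := Finset.card_pos.2 ⟨v, hvW⟩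
    rw [Finset.card_insert_of_notMem, Finset.card_insert_of_notMem (fun h => hbT (hsubT h)), hpeW]
    · omega
    · rw [Finset.mem_insert, not_or]
      exact ⟨hab, fun h => haT (hsubT h)⟩
  have hSW : (insert a (insert b ((W.erase v).image pe))).biUnion e ⊆ W := by
    refine Finset.biUnion_subset.2 fun i hi => ?_
    have hends : ∀ u ∈ e a ∪ e b, u ∈ W := fun u hu =>
      Finset.mem_insert_of_mem (Finset.mem_biUnion.2 ⟨u, hu, hWself u (habB hu)⟩)
    rcases Finset.mem_insert.1 hi with rfl | hi
    · exact fun u hu => hends u (Finset.mem_union_left _ hu)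
    rcases Finset.mem_insert.1 hi with rfl | hi
    · exact fun u hu => hends u (Finset.mem_union_right _ hu)
    obtain ⟨u, hu, rfl⟩ := Finset.mem_image.1 hi
    obtain ⟨huv, huW⟩ := Finset.mem_erase.1 hu
    rw [hpe u ⟨hWsub huW, huv⟩]
    simp [Finset.insert_subset_iff, huW, hWclosed u huW huv]
  refine ⟨insert a (insert b ((W.erase v).image pe)), ?_, ?_, by omega⟩
  · refine Finset.insert_subset haE (Finset.insert_subset hbE ?_)
    intro i hi
    obtain ⟨u, hu, rfl⟩ := Finset.mem_image.1 hi
    obtain ⟨huv, huW⟩ := Finset.mem_erase.1 hu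
    exact hpeE u ⟨hWsub huW, huv⟩
  · have := Finset.card_le_card hSW
    omega

/-- Bernoulli's inequality `(1 + 1/d) ^ d ≥ 2`: growth by `1 + 1/d` doubles every `d` steps. -/
theorem two_mul_pow_le_succ_pow (d : ℕ) (hd : 0 < d) : 2 * d ^ d ≤ (d + 1) ^ d := by
  have key : ∀ k : ℕ, d ^ k * (d + k) ≤ d * (d + 1) ^ k := by
    intro k
    induction k with
    | zero => simp
    | succ k ih =>
      calc d ^ (k + 1) * (d + (k + 1)) = d ^ k * (d * (d + k + 1)) := by ring
        _ ≤ d ^ k * ((d + k) * (d + 1)) := Nat.mul_le_mul_left _ (by nlinarith)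
        _ = d ^ k * (d + k) * (d + 1) := by ring
        _ ≤ d * (d + 1) ^ k * (d + 1) := Nat.mul_le_mul_right _ ih
        _ = d * (d + 1) ^ (k + 1) := by ring
  have := key d
  refine le_of_mul_le_mul_left ?_ hd
  calc d * (2 * d ^ d) = d ^ d * (d + d) := by ring
    _ ≤ _ := this

/-- A graph with at least `(1 + 1/d)` times as many edges as vertices contains a subgraph with
more edges than vertices and only `O(d log |E|)` edges. -/
theorem exists_small_dense [Fintype V] {e : ι → Finset V} {E : Finset ι}
    (he : ∀ i ∈ E, (e i).card ≤ 2) (hne : E.Nonempty) {d A : ℕ}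
    (hE : (d + 1) * Fintype.card V ≤ d * E.card) (hA : E.card ≤ 2 ^ A) :
    ∃ S ⊆ E, (S.biUnion e).card < S.card ∧ S.card ≤ 4 * (d * A) + 10 := by
  classical
  -- An empty edge alone has more edges than vertices.
  by_cases hempty : ∃ i ∈ E, e i = ∅
  · obtain ⟨i, hi, h⟩ := hempty
    exact ⟨{i}, by simpa using hi, by simp [h], by simp⟩
  push Not at hempty
  have hVpos : 0 < Fintype.card V := by
    obtain ⟨i, hi⟩ := hne
    obtain ⟨u, -⟩ := hempty i hi
    exact Fintype.card_pos_iff.2 ⟨u⟩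
  have hd : 0 < d := by
    rcases Nat.eq_zero_or_pos d with rfl | h
    · omega
    · exact h
  have hVE : Fintype.card V ≤ E.card :=
    Nat.le_of_mul_le_mul_left (by nlinarith : d * Fintype.card V ≤ d * E.card) hd
  -- `U` is a smallest nonempty vertex set whose induced density is at least `1 + 1/d`.
  obtain ⟨U, hU, hmin⟩ := Finset.exists_min_image
    ((Finset.univ : Finset (Finset V)).filter fun U => U.Nonempty ∧
      (d + 1) * U.card ≤ d * (E.filter fun i => e i ⊆ U).card) Finset.card
    ⟨Finset.univ, by simpa [Finset.univ_nonempty_iff, ← Fintype.card_pos_iff] using ⟨hVpos, hE⟩⟩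
  simp only [Finset.mem_filter, Finset.mem_univ, true_and] at hU hmin
  obtain ⟨⟨v, hv⟩, hUd⟩ := hU
  have hsmall : ∀ X ⊆ U, X.Nonempty →
      d * (E.filter fun i => e i ⊆ U \ X).card ≤ (d + 1) * (U \ X).card := by
    intro X hX hXne
    rcases Finset.eq_empty_or_nonempty (U \ X) with h0 | h0
    · rw [h0, Finset.filter_eq_empty_iff.2]
      · simp
      · intro i hi h
        exact (hempty i hi).ne_empty (Finset.subset_empty.1 h)
    · by_contra hlt
      have h1 := hmin (U \ X) ⟨h0, (not_le.1 hlt).le⟩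
      have h2 : (U \ X).card < U.card := by
        rw [Finset.card_sdiff_of_subset hX]
        have := Finset.card_pos.2 hXne
        have := Finset.card_le_card hX
        omega
      omega
  set E' := E.filter fun i => e i ⊆ U with hE'
  have hE'U : ∀ i ∈ E', e i ⊆ U := fun i hi => (Finset.mem_filter.1 hi).2
  -- By minimality, deleting the ball from `U` removes at least `1 + 1/d` edges per vertex, and all
  -- of these lie in the next ball.
  have hgrow : ∀ j, (d + 1) * (hyperBall e E' v j).card ≤
      d * (E'.filter fun i => e i ⊆ hyperBall e E' v (j + 1)).card := by
    intro j
    set X := hyperBall e E' v j with hX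
    have hXU : X ⊆ U := hyperBall_subset hv hE'U j
    have h1 := hsmall X hXU ⟨v, mem_hyperBall e E' v j⟩
    have h2 : E' ⊆ (E'.filter fun i => e i ⊆ hyperBall e E' v (j + 1)) ∪
        E.filter fun i => e i ⊆ U \ X := by
      intro i hi
      by_cases hdis : Disjoint (e i) X
      · refine Finset.mem_union_right _ (Finset.mem_filter.2 ⟨(Finset.mem_filter.1 hi).1, ?_⟩)
        exact Finset.subset_sdiff.2 ⟨hE'U i hi, hdis⟩
      · refine Finset.mem_union_left _ (Finset.mem_filter.2 ⟨hi, ?_⟩)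
        exact (Finset.subset_biUnion_of_mem e (Finset.mem_filter.2 ⟨hi, hdis⟩)).trans
          Finset.subset_union_right
    have h3 := (Finset.card_le_card h2).trans (Finset.card_union_le _ _)
    have h4 : (U \ X).card + X.card = U.card := Finset.card_sdiff_add_card_eq_card hXU
    have h5 := Nat.mul_le_mul_left d h3
    rw [← h4] at hUd
    nlinarith
  by_cases hex : ∃ j ≤ d * A + 1,
      (hyperBall e E' v j).card < (E'.filter fun i => e i ⊆ hyperBall e E' v j).card
  · obtain ⟨j, hj, h⟩ := hex
    obtain ⟨S, hS, h1, h2⟩ :=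
      exists_dense_of_hyperBall (fun i hi => he i (Finset.mem_filter.1 hi).1) h
    exact ⟨S, hS.trans (Finset.filter_subset _ _), h1, by omega⟩
  · exfalso
    push Not at hex
    -- If no ball has more edges than vertices, the growth of edges is growth of vertices. After `d
    -- * A` steps the ball has reached `2 ^ A` vertices; one more step makes the contradiction
    -- strict.
    have hpow : ∀ j ≤ d * A + 1, (d + 1) ^ j ≤ d ^ j * (hyperBall e E' v j).card := by
      intro j
      induction j with
      | zero => simp [hyperBall]
      | succ j ih =>
        intro hj
        have h1 := ih (by omega)
        have h2 := (hgrow j).trans (Nat.mul_le_mul_left d (hex (j + 1) hj))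
        calc (d + 1) ^ (j + 1) = (d + 1) ^ j * (d + 1) := pow_succ _ _
          _ ≤ d ^ j * (hyperBall e E' v j).card * (d + 1) := Nat.mul_le_mul_right _ h1
          _ = d ^ j * ((d + 1) * (hyperBall e E' v j).card) := by ring
          _ ≤ d ^ j * (d * (hyperBall e E' v (j + 1)).card) := Nat.mul_le_mul_left _ h2
          _ = _ := by ring
    have h1 := hpow (d * A + 1) le_rfl
    have h2 : (hyperBall e E' v (d * A + 1)).card ≤ 2 ^ A :=
      (Finset.card_le_univ _).trans (hVE.trans hA)
    have h3 : 2 ^ A * d ^ (d * A) ≤ (d + 1) ^ (d * A) := by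
      rw [pow_mul, pow_mul, ← mul_pow]
      exact Nat.pow_le_pow_left (two_mul_pow_le_succ_pow d hd) A
    have h4 : 0 < d ^ (d * A) * 2 ^ A := by positivity
    have h5 := Nat.mul_le_mul_left (d ^ (d * A + 1)) h2
    have h6 := Nat.mul_le_mul_right (d + 1) h3
    have h7 := h1.trans h5
    rw [pow_succ, pow_succ] at h7
    nlinarith

/-- A graph with at least twice as many edges as vertices, and some more, contains a small subgraph
whose number of edges exceeds the number of vertices by `q`. -/
theorem exists_small_excess [Fintype V] {e : ι → Finset V} {A : ℕ} (q : ℕ) {E : Finset ι}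
    (he : ∀ i ∈ E, (e i).card ≤ 2) (hA : E.card ≤ 2 ^ A)
    (hE : 2 * Fintype.card V + q * (4 * A + 10) ≤ E.card) :
    ∃ S ⊆ E, (S.biUnion e).card + q ≤ S.card ∧ S.card ≤ q * (4 * A + 10) := by
  classical
  induction q generalizing E with
  | zero => exact ⟨∅, by simp, by simp, by simp⟩
  | succ q ih =>
    have hq : (q + 1) * (4 * A + 10) = q * (4 * A + 10) + (4 * A + 10) := by ring
    -- Removing `S` costs at most `4 * A + 10` edges, which the hypothesis has in reserve for each
    -- of the rounds. Overlapping vertex sets only help.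
    obtain ⟨S, hSE, h1, h2⟩ := exists_small_dense (d := 1) he (Finset.card_pos.1 (by omega))
      (by omega) hA
    have hsd := Finset.card_sdiff_of_subset hSE
    have hle := Finset.card_le_card hSE
    obtain ⟨S', hS'E, h1', h2'⟩ := ih (E := E \ S) (fun i hi => he i (Finset.mem_sdiff.1 hi).1)
      (by omega) (by omega)
    have hdis : Disjoint S S' :=
      (Finset.disjoint_sdiff (s := S) (t := E)).mono_right hS'E
    refine ⟨S ∪ S', Finset.union_subset hSE (hS'E.trans Finset.sdiff_subset), ?_, ?_⟩
    · rw [Finset.union_biUnion, Finset.card_union_of_disjoint hdis]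
      have := Finset.card_union_le (S.biUnion e) (S'.biUnion e)
      omega
    · rw [Finset.card_union_of_disjoint hdis]
      omega

/-! ### From hypergraphs to graphs -/

/-- The `r` heaviest of `s` elements carry at least an `r / s` fraction of the weight. -/
theorem exists_heavy [Fintype V] (w : V → ℕ) {r : ℕ} (hr : r ≤ Fintype.card V) :
    ∃ R : Finset V, R.card = r ∧ r * ∑ x, w x ≤ Fintype.card V * ∑ x ∈ R, w x := by
  induction r with
  | zero => exact ⟨∅, by simp, by simp⟩
  | succ r ih =>
    obtain ⟨R, hR, h⟩ := ih (by omega)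
    have hc : Rᶜ.card = Fintype.card V - r := by rw [Finset.card_compl, hR]
    obtain ⟨x, hx, hmax⟩ := Finset.exists_max_image Rᶜ w (Finset.card_pos.1 (by omega))
    have hxR : x ∉ R := Finset.mem_compl.1 hx
    refine ⟨insert x R, by rw [Finset.card_insert_of_notMem hxR, hR], ?_⟩
    rw [Finset.sum_insert hxR]
    have h1 : ∑ y ∈ Rᶜ, w y ≤ Rᶜ.card * w x := by
      simpa using Finset.sum_le_card_nsmul Rᶜ w (w x) hmax
    have h2 := Finset.sum_add_sum_compl R w
    rw [hc] at h1
    obtain ⟨u, hu⟩ : ∃ u, Fintype.card V = r + 1 + u := ⟨_, (Nat.add_sub_of_le hr).symm⟩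
    rw [hu] at h h1 ⊢
    have hsub : r + 1 + u - r = u + 1 := by omega
    rw [hsub] at h1
    rw [← h2] at h ⊢
    generalize ∑ y ∈ R, w y = a at *
    generalize ∑ y ∈ Rᶜ, w y = c at *
    generalize w x = z at *
    have h3 : (u + 1) * ((r + 1) * (a + c)) ≤ (u + 1) * ((r + 1 + u) * (z + a)) := by
      nlinarith [Nat.mul_le_mul_left u h, Nat.mul_le_mul_left (r + 1 + u) h1]
    exact Nat.le_of_mul_le_mul_left h3 (Nat.succ_pos u)

/-- Some `r` vertices meet an `r / s` fraction of the edges. -/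
theorem exists_hitting_set [Fintype V] (e : ι → Finset V) (E : Finset ι) {t r : ℕ}
    (he : ∀ i ∈ E, (e i).card ≤ t + 1) (hr : r ≤ Fintype.card V) :
    ∃ R : Finset V, R.card ≤ r ∧ ∃ E' ⊆ E, r * E.card ≤ Fintype.card V * E'.card ∧
      ∀ i ∈ E', (e i \ R).card ≤ t := by
  rcases isEmpty_or_nonempty V with hV | hV
  · exact ⟨∅, by simp, ∅, by simp, by simp_all, by simp⟩
  -- Charge each edge to one of its vertices, so that the weights sum to `|E|`. An empty edge may be
  -- charged anywhere, having nothing to remove.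
  have : ∀ i, ∃ x, (e i).Nonempty → x ∈ e i := by
    intro i
    rcases (e i).eq_empty_or_nonempty with h | ⟨x, hx⟩
    · exact ⟨Classical.arbitrary V, fun h' => absurd h h'.ne_empty⟩
    · exact ⟨x, fun _ => hx⟩
  choose c hc using this
  obtain ⟨R, hR, h⟩ := exists_heavy (fun x => (E.filter fun i => c i = x).card) hr
  refine ⟨R, hR.le, E.filter fun i => c i ∈ R, Finset.filter_subset _ _, ?_, ?_⟩
  · have h1 := Finset.card_eq_sum_card_fiberwise (f := c) (s := E) (t := Finset.univ)
      fun _ _ => Finset.mem_coe.2 (Finset.mem_univ _)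
    have h2 := Finset.card_eq_sum_card_fiberwise (f := c) (s := E.filter fun i => c i ∈ R) (t := R)
      fun i hi => (Finset.mem_filter.1 hi).2
    rw [h1, h2]
    refine h.trans (Nat.mul_le_mul_left _ (Finset.sum_le_sum fun x hx => ?_))
    refine Finset.card_le_card fun i hi => ?_
    obtain ⟨hiE, rfl⟩ := Finset.mem_filter.1 hi
    simp [hiE, hx]
  · intro i hi
    obtain ⟨hiE, hiR⟩ := Finset.mem_filter.1 hi
    rcases (e i).eq_empty_or_nonempty with h0 | h0
    · simp [h0]
    · have h1 : e i \ R ⊆ (e i).erase (c i) := by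
        intro x hx
        obtain ⟨hx, hxR⟩ := Finset.mem_sdiff.1 hx
        exact Finset.mem_erase.2 ⟨fun h => hxR (h ▸ hiR), hx⟩
      have h2 := Finset.card_le_card h1
      rw [Finset.card_erase_of_mem (hc i h0)] at h2
      have := he i hiE
      omega

/-- Iterates `exists_hitting_set` on the edges with the selected vertices deleted: each round costs
`r` vertices, keeps an `r / |V|` fraction of the edges and lowers the size bound by one. -/
theorem exists_reduction_to_graph [Fintype V] {r : ℕ} (hr : r ≤ Fintype.card V) (u : ℕ)
    (e : ι → Finset V) (E : Finset ι) (he : ∀ i ∈ E, (e i).card ≤ u + 2) :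
    ∃ R : Finset V, R.card ≤ u * r ∧ ∃ E' ⊆ E, r ^ u * E.card ≤ Fintype.card V ^ u * E'.card ∧
      ∀ i ∈ E', (e i \ R).card ≤ 2 := by
  induction u generalizing e E with
  | zero => exact ⟨∅, by simp, E, subset_rfl, by simp, by simpa using he⟩
  | succ u ih =>
    obtain ⟨R, hR, E', hE', h, hc⟩ := exists_hitting_set e E (t := u + 2) he hr
    obtain ⟨R', hR', E'', hE'', h', hc'⟩ := ih (fun i => e i \ R) E' hc
    refine ⟨R ∪ R', ?_, E'', hE''.trans hE', ?_, ?_⟩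
    · have := Finset.card_union_le R R'
      have : (u + 1) * r = u * r + r := by ring
      omega
    · calc r ^ (u + 1) * E.card = r ^ u * (r * E.card) := by ring
        _ ≤ r ^ u * (Fintype.card V * E'.card) := Nat.mul_le_mul_left _ h
        _ = Fintype.card V * (r ^ u * E'.card) := by ring
        _ ≤ Fintype.card V * (Fintype.card V ^ u * E''.card) := Nat.mul_le_mul_left _ h'
        _ = _ := by ring
    · intro i hi
      have := hc' i hi
      rwa [sdiff_sdiff_left] at this

end Hypergraph

/-! ### Space bounds for `k`-wise independent problems -/

section KWise

variable {F : Type*} [Fintype F] [Nontrivial F] {n m k : ℕ} {f : (Fin n → F) → Fin m → F}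

theorem KWiseIndependent.surjective (hf : KWiseIndependent k f) {S : Finset (Fin m)}
    (hS : S.card = k) : Function.Surjective fun x (i : S) => f x i := by
  classical
  intro y
  have h : y ∈ (PMF.uniformOfFintype (S → F)).support := PMF.mem_support_uniformOfFintype y
  rw [← hf S hS, PMF.mem_support_map_iff] at h
  obtain ⟨x, -, hx⟩ := h
  exact ⟨x, hx⟩

/-- In a data structure for a `k`-wise independent problem, any `k` queries or fewer probe
at least as many cells as there are queries. -/
theorem KWiseIndependent.card_le_card_biUnion (hf : KWiseIndependent k f) (hkm : k ≤ m) {s : ℕ}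
    {pre : (Fin n → F) → Fin s → F} {probe : Fin m → Finset (Fin s)}
    {answer : (i : Fin m) → (probe i → F) → F}
    (h : ∀ x i, answer i (fun c => pre x c) = f x i) {S : Finset (Fin m)} (hS : S.card ≤ k) :
    S.card ≤ (S.biUnion probe).card := by
  classical
  -- Independence speaks of exactly `k` outputs, so `S` is enlarged; this needs `k ≤ m`.
  obtain ⟨S', hSS', hS'⟩ := Finset.exists_superset_card_eq hS (by simpa using hkm)
  have hsurj : Function.Surjective fun x (i : S) => f x i := by
    intro y
    obtain ⟨x, hx⟩ := hf.surjective hS' fun i => if hi : i.1 ∈ S then y ⟨i, hi⟩ else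
      Classical.arbitrary F
    refine ⟨x, funext fun i => ?_⟩
    have := congrFun hx ⟨i, hSS' i.2⟩
    simpa using this
  let g : (S.biUnion probe → F) → S → F := fun z i =>
    answer i fun c => z ⟨c, Finset.mem_biUnion.2 ⟨i, i.2, c.2⟩⟩
  have hg : Function.Surjective g := by
    intro y
    obtain ⟨x, hx⟩ := hsurj y
    refine ⟨fun c => pre x c, ?_⟩
    rw [← hx]
    exact funext fun i => h x i
  have := Fintype.card_le_of_surjective g hg
  simp only [Fintype.card_fun, Fintype.card_coe] at this
  exact (Nat.pow_le_pow_iff_right Fintype.one_lt_card).1 this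

theorem KWiseIndependent.le_space (hf : KWiseIndependent k f) (hkm : k ≤ m) {s t : ℕ}
    (h : HasNonAdaptiveDS f s t) : k ≤ s := by
  obtain ⟨pre, probe, answer, -, h⟩ := h
  obtain ⟨S, -, hS⟩ := Finset.exists_subset_card_eq (s := (Finset.univ : Finset (Fin m)))
    (by simpa using hkm)
  have h1 := hf.card_le_card_biUnion hkm h hS.le
  have h2 := Finset.card_le_univ (S.biUnion probe)
  rw [Fintype.card_fin] at h2
  omega

theorem KWiseIndependent.two_probe (hf : KWiseIndependent k f) (hkm : k ≤ m) {s d A : ℕ}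
    (h : HasNonAdaptiveDS f s 2) (hA : m ≤ 2 ^ A) (hk : 4 * (d * A) + 10 ≤ k) :
    d * m < (d + 1) * s := by
  obtain ⟨pre, probe, answer, hc, h⟩ := h
  by_contra hlt
  obtain ⟨S, -, h1, h2⟩ := exists_small_dense (E := Finset.univ) (e := probe) (fun i _ => hc i)
    (Finset.card_pos.1 (by simp; omega)) (d := d) (A := A) (by simpa using hlt) (by simpa using hA)
  have := hf.card_le_card_biUnion hkm h (h2.trans hk)
  omega

/-- Otherwise, outside some `R` of at most `u * r` cells, at least `3 * s` queries form a graph. An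
edge excess of `|R| + 1` there outweighs `R` even if all of it is probed. -/
theorem KWiseIndependent.multi_probe (hf : KWiseIndependent k f) (hkm : k ≤ m) {s u r A : ℕ}
    (h : HasNonAdaptiveDS f s (u + 2)) (hA : m ≤ 2 ^ A) (hu : 1 ≤ u)
    (hk : (u * r + 1) * (4 * A + 10) ≤ k) : r ^ u * m < 3 * s ^ (u + 1) := by
  have hks := hf.le_space hkm h
  obtain ⟨pre, probe, answer, hc, h⟩ := h
  have hrk : r ≤ k := by
    refine le_trans ?_ hk
    calc r ≤ u * r + 1 := (Nat.le_mul_of_pos_left r hu).trans (Nat.le_succ _)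
      _ ≤ _ := Nat.le_mul_of_pos_right _ (by omega)
  by_contra hlt
  obtain ⟨R, hR, E, -, hE, hc'⟩ := exists_reduction_to_graph (r := r)
    (by simpa using hrk.trans hks) u probe Finset.univ fun i _ => hc i
  rw [Fintype.card_fin, Finset.card_univ, Fintype.card_fin] at hE
  have hs : 0 < s := by nlinarith
  have hE' : 3 * s ≤ E.card := by
    have h1 : s ^ u * (3 * s) ≤ s ^ u * E.card := by
      refine le_trans ?_ hE
      rw [not_lt] at hlt
      calc s ^ u * (3 * s) = 3 * s ^ (u + 1) := by ring
        _ ≤ _ := hlt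
    exact le_of_mul_le_mul_left h1 (by positivity)
  have hq : (R.card + 1) * (4 * A + 10) ≤ k :=
    (Nat.mul_le_mul_right _ (Nat.add_le_add_right hR 1)).trans hk
  -- Of the `3 * s` edges, `2 * s` give the density and `s ≥ k` pays for the removed subgraphs.
  obtain ⟨S, -, h1, h2⟩ := exists_small_excess (A := A) (R.card + 1) hc'
    ((Finset.card_le_univ E).trans (by simpa using hA)) (by rw [Fintype.card_fin]; omega)
  have h3 := hf.card_le_card_biUnion hkm h (h2.trans hq)
  have h4 : S.biUnion probe ⊆ R ∪ S.biUnion fun i => probe i \ R := by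
    intro c hc
    obtain ⟨i, hi, hci⟩ := Finset.mem_biUnion.1 hc
    by_cases hcR : c ∈ R
    · exact Finset.mem_union_left _ hcR
    · exact Finset.mem_union_right _
        (Finset.mem_biUnion.2 ⟨i, hi, Finset.mem_sdiff.2 ⟨hci, hcR⟩⟩)
  have h5 := (Finset.card_le_card h4).trans (Finset.card_union_le _ _)
  omega

end KWise

/-! ### Asymptotic form of the bounds -/

theorem eventually_mul_logb_pow_le (K : ℝ) (a : ℕ) :
    ∀ᶠ n : ℕ in atTop, K * Real.logb 2 n ^ a ≤ n := by
  have h1 : (fun x : ℝ => K * Real.logb 2 x ^ a) =o[atTop] (id : ℝ → ℝ) := by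
    have : (fun x : ℝ => K * Real.logb 2 x ^ a) =
        fun x => K / Real.log 2 ^ a * Real.log x ^ a := by
      ext x
      rw [Real.logb, div_pow]
      ring
    rw [this]
    exact Real.isLittleO_pow_log_id_atTop.const_mul_left _
  have h2 := (h1.comp_tendsto tendsto_natCast_atTop_atTop).bound (zero_lt_one' ℝ)
  filter_upwards [h2] with n hn
  simpa using (le_abs_self _).trans hn

theorem eventually_one_le_logb : ∀ᶠ n : ℕ in atTop, 1 ≤ Real.logb 2 n := by
  filter_upwards [eventually_ge_atTop 2] with n hn
  rw [Real.le_logb_iff_rpow_le one_lt_two (by positivity)]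
  simpa using hn

theorem exists_eventually_le_pow {m : ℕ → ℕ} (hpoly : ∃ P : Polynomial ℕ, ∀ n, m n ≤ P.eval n) :
    ∃ D : ℕ, 1 ≤ D ∧ ∀ᶠ n in atTop, m n ≤ n ^ D := by
  obtain ⟨P, hP⟩ := hpoly
  -- The extra factor `n` absorbs the sum of the coefficients.
  refine ⟨P.natDegree + 1, by omega, ?_⟩
  filter_upwards [eventually_ge_atTop (P.eval 1), eventually_ge_atTop 1] with n hn h1
  refine (hP n).trans ?_
  rw [pow_succ', Polynomial.eval_eq_sum_range]
  refine le_trans ?_ (Nat.mul_le_mul_right _ hn)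
  rw [Polynomial.eval_eq_sum_range, Finset.sum_mul]
  refine Finset.sum_le_sum fun i hi => ?_
  rw [one_pow, mul_one]
  exact Nat.mul_le_mul_left _
    (Nat.pow_le_pow_right h1 (Nat.lt_succ_iff.1 (Finset.mem_range.1 hi)))

theorem le_two_pow_log (n D : ℕ) : n ^ D ≤ 2 ^ (D * (Nat.log 2 n + 1)) := by
  rw [mul_comm, pow_mul]
  exact Nat.pow_le_pow_left (Nat.lt_pow_succ_log_self one_lt_two n).le D

theorem cast_mul_log_le {n D : ℕ} (hn : 1 ≤ Real.logb 2 n) :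
    ((D * (Nat.log 2 n + 1) : ℕ) : ℝ) ≤ 2 * D * Real.logb 2 n := by
  have h1 := Real.natLog_le_logb n 2
  push_cast at h1 ⊢
  have h2 : (0 : ℝ) ≤ D := Nat.cast_nonneg D
  nlinarith

section KWise

variable {F : Type*} [Fintype F] [Nontrivial F] {n m k : ℕ} {f : (Fin n → F) → Fin m → F}

theorem KWiseIndependent.two_probe_real (hf : KWiseIndependent k f) (hkm : k ≤ m) {s A : ℕ}
    (h : HasNonAdaptiveDS f s 2) (hA : m ≤ 2 ^ A) (hA0 : 0 < A) (hk : 20 ≤ k) :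
    (m : ℝ) - m * (8 * A / k) ≤ s := by
  have hA0' : (0 : ℝ) < A := Nat.cast_pos.2 hA0
  -- The largest admissible `d`. As `k ≥ 20`, `k - 10 ≥ k / 2`, whence `1 / (d + 1) ≤ 8 * A / k`.
  set d := (k - 10) / (4 * A) with hd
  have h1 : 4 * (d * A) + 10 ≤ k := by
    have := Nat.div_mul_le_self (k - 10) (4 * A)
    have h2 : d * (4 * A) = 4 * (d * A) := by ring
    rw [← hd, h2] at this
    omega
  have h2 : ((d * m : ℕ) : ℝ) ≤ ((d + 1) * s : ℕ) := Nat.cast_le.2 (hf.two_probe hkm h hA h1).le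
  push_cast at h2
  have h3 : k ≤ 8 * A * (d + 1) := by
    have := Nat.lt_div_mul_add (a := k - 10) (b := 4 * A) (by omega)
    rw [← hd] at this
    have h4 : 8 * A * (d + 1) = 2 * (d * (4 * A) + 4 * A) := by ring
    omega
  have h3' : (k : ℝ) ≤ 8 * A * (d + 1) := by exact_mod_cast h3
  have hk0 : (0 : ℝ) < k := by exact_mod_cast (by omega : 0 < k)
  have hd0 : (0 : ℝ) < d + 1 := by positivity
  have h4 : 1 / ((d : ℝ) + 1) ≤ 8 * A / k := by
    rw [div_le_div_iff₀ hd0 hk0]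
    linarith
  have hm0 : (0 : ℝ) ≤ m := Nat.cast_nonneg m
  have h5 : (m : ℝ) - m * (1 / (d + 1)) ≤ s := by
    have : (m : ℝ) - m * (1 / (d + 1)) = d * m / (d + 1) := by
      field_simp
      ring
    rw [this, div_le_iff₀ hd0]
    linarith
  have := mul_le_mul_of_nonneg_left h4 hm0
  linarith

theorem KWiseIndependent.multi_probe_real (hf : KWiseIndependent k f) (hkm : k ≤ m) {s t A : ℕ}
    (h : HasNonAdaptiveDS f s t) (ht : 3 ≤ t) (hA : m ≤ 2 ^ A) (hA0 : 0 < A)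
    (hk : A * (4 * A + 10) ≤ k) (hkn : k ≤ n) (hnm : n ≤ m) :
    (k : ℝ) * ((m : ℝ) / n) ^ (1 / ((t : ℝ) - 1)) * (1 / (2 ^ t * (84 * A))) ≤ s := by
  have hks : (k : ℝ) ≤ s := Nat.cast_le.2 (hf.le_space hkm h)
  have hk0 : 0 < k := lt_of_lt_of_le (by positivity) hk
  have hn0 : (0 : ℝ) < n := by exact_mod_cast hk0.trans_le hkn
  have hA1 : (1 : ℝ) ≤ A := by exact_mod_cast hA0
  have hmn : 1 ≤ (m : ℝ) / n := by
    rw [one_le_div hn0]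
    exact_mod_cast hnm
  obtain ⟨u, rfl⟩ : ∃ u, t = u + 2 := ⟨t - 2, by omega⟩
  have hu : 1 ≤ u := by omega
  have hu' : (((u + 2 : ℕ) : ℝ) - 1) = ((u + 1 : ℕ) : ℝ) := by
    push_cast
    ring
  rw [hu']
  set X := ((m : ℝ) / n) ^ (1 / ((u + 1 : ℕ) : ℝ)) with hX
  have hX0 : 0 ≤ X := by positivity
  have hXpow : X ^ (u + 1) = (m : ℝ) / n := by
    rw [hX, one_div, Real.rpow_inv_natCast_pow (by positivity) (by omega)]
  have hut : ((u + 1 : ℕ) : ℝ) ≤ 2 ^ (u + 2) := by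
    have : u + 1 ≤ 2 ^ (u + 2) := (by omega : u + 1 ≤ u + 2).trans (Nat.lt_two_pow_self).le
    exact_mod_cast this
  -- For `t ≥ A` the factor `2 ^ t` exceeds `m` and the claim follows from `k ≤ s`; for `t < A` the
  -- radius parameter `r` below is positive.
  rcases le_or_gt A (u + 2) with hcase | hcase
  · have hX1 : X ≤ 2 ^ (u + 2) := by
      calc X ≤ ((m : ℝ) / n) ^ (1 : ℝ) := by
            refine Real.rpow_le_rpow_of_exponent_le hmn ?_
            rw [div_le_one (by positivity)]
            exact_mod_cast (by omega : 1 ≤ u + 1)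
        _ = (m : ℝ) / n := Real.rpow_one _
        _ ≤ m := div_le_self (Nat.cast_nonneg m) (by exact_mod_cast hk0.trans_le hkn)
        _ ≤ 2 ^ A := by exact_mod_cast hA
        _ ≤ 2 ^ (u + 2) := pow_le_pow_right₀ one_le_two hcase
    refine le_trans ?_ hks
    have h84 : X * (1 / (2 ^ (u + 2) * (84 * A))) ≤ 1 := by
      rw [mul_one_div, div_le_one (by positivity)]
      calc X ≤ 2 ^ (u + 2) * 1 := by simpa using hX1
        _ ≤ _ := by
          gcongr
          linarith
    rw [mul_assoc]
    exact mul_le_of_le_one_right (Nat.cast_nonneg k) h84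
  · set L := 4 * A + 10 with hL
    set r := k / ((u + 1) * L) with hr
    have hLk : (u + 1) * L ≤ k := (Nat.mul_le_mul_right L (by omega)).trans hk
    have hr1 : 1 ≤ r := (Nat.one_le_div_iff (by positivity)).2 hLk
    have hrk : r * ((u + 1) * L) ≤ k := Nat.div_mul_le_self _ _
    have hcond : (u * r + 1) * L ≤ k := by
      refine le_trans ?_ hrk
      calc (u * r + 1) * L ≤ (u * r + r) * L := by gcongr
        _ = _ := by ring
    have hmain : ((r ^ u * m : ℕ) : ℝ) ≤ (3 * s ^ (u + 1) : ℕ) :=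
      Nat.cast_le.2 (hf.multi_probe hkm h hA hu hcond).le
    push_cast at hmain
    have hrn : (r : ℝ) ≤ n := by
      have : r ≤ k := Nat.div_le_self _ _
      exact_mod_cast this.trans hkn
    have hr0 : (0 : ℝ) < r := by exact_mod_cast hr1
    -- Take the `(u + 1)`-st root of `r ^ u * m ≤ 3 * s ^ (u + 1)`, using `r ≤ n` to trade `m` for
    -- `r * m / n`.
    have hsr : (r : ℝ) / 3 * X ≤ s := by
      refine le_of_pow_le_pow_left₀ (n := u + 1) (by omega) (Nat.cast_nonneg s) ?_
      rw [mul_pow, hXpow, div_pow]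
      have h3 : (3 : ℝ) ≤ 3 ^ (u + 1) := le_self_pow₀ (by norm_num) (by omega)
      calc (r : ℝ) ^ (u + 1) / 3 ^ (u + 1) * (m / n) ≤ (r : ℝ) ^ (u + 1) / 3 * (m / n) := by gcongr
        _ = r ^ u * m / 3 * (r / n) := by
          field_simp
          ring
        _ ≤ r ^ u * m / 3 * 1 := by
          gcongr
          rwa [div_le_one hn0]
        _ ≤ s ^ (u + 1) := by linarith
    refine le_trans ?_ hsr
    -- Rounding in `r` loses a factor 2, `L ≤ 14 * A`, and `u + 1 ≤ 2 ^ t`; with the 3 above this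
    -- gives 84.
    have hkr : (k : ℝ) ≤ r * (28 * (A * 2 ^ (u + 2))) := by
      have h1 : k ≤ 2 * (r * ((u + 1) * L)) := by
        have := Nat.lt_div_mul_add (a := k) (b := (u + 1) * L) (by positivity)
        rw [← hr] at this
        nlinarith
      have h2 : L ≤ 14 * A := by omega
      have h3 : k ≤ 2 * (r * ((u + 1) * (14 * A))) := h1.trans (by gcongr)
      have h4 : (k : ℝ) ≤ 2 * (r * (((u + 1 : ℕ) : ℝ) * (14 * A))) := by exact_mod_cast h3
      refine h4.trans ?_
      calc 2 * ((r : ℝ) * (((u + 1 : ℕ) : ℝ) * (14 * A)))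
          ≤ 2 * ((r : ℝ) * ((2 ^ (u + 2)) * (14 * A))) := by gcongr
        _ = _ := by ring
    rw [mul_one_div, div_le_iff₀ (by positivity)]
    calc (k : ℝ) * X ≤ r * (28 * (A * 2 ^ (u + 2))) * X := by gcongr
      _ = _ := by ring

end KWise

/-- The two lower bounds for `k`-wise independent problems with `k = Θ(n / log n)`. -/
theorem lowerBounds_of_kWiseIndependent {F : Type*} [Fintype F] [Nontrivial F] {m : ℕ → ℕ}
    (hpoly : ∃ P : Polynomial ℕ, ∀ n, m n ≤ P.eval n) (hle : ∀ᶠ n in atTop, n ≤ m n)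
    {k : ℕ → ℕ} {f : (n : ℕ) → (Fin n → F) → Fin (m n) → F}
    (hk : (fun n => (k n : ℝ)) =Θ[atTop] (fun n : ℕ => (n : ℝ) / Real.logb 2 n))
    (hf : ∀ᶠ n in atTop, KWiseIndependent (k n) (f n)) :
    TwoProbeLowerBound f ∧ MultiProbeLowerBound f := by
  obtain ⟨D, hD1, hD⟩ := exists_eventually_le_pow hpoly
  have hD0 : (1 : ℝ) ≤ D := by exact_mod_cast hD1
  obtain ⟨C, hC0, hC⟩ := hk.1.exists_pos
  obtain ⟨C', hC'0, hC'⟩ := hk.2.exists_pos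
  -- The exponent `A = D * (Nat.log 2 n + 1)` satisfies `m ≤ 2 ^ A` and is `O(log n)`.
  have hbase : ∀ᶠ n : ℕ in atTop, 1 ≤ Real.logb 2 n ∧ (0 : ℝ) < n ∧
      (n : ℝ) / Real.logb 2 n ≤ C' * k n ∧ 20 ≤ k n ∧ k n ≤ n ∧
      m n ≤ 2 ^ (D * (Nat.log 2 n + 1)) ∧
      D * (Nat.log 2 n + 1) * (4 * (D * (Nat.log 2 n + 1)) + 10) ≤ k n := by
    filter_upwards [eventually_one_le_logb, hC.bound, hC'.bound, hD, eventually_gt_atTop 0,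
      eventually_mul_logb_pow_le (20 * C') 1, eventually_mul_logb_pow_le (56 * D ^ 2 * C') 3,
      (Real.tendsto_logb_atTop one_lt_two).comp (tendsto_natCast_atTop_atTop (R := ℝ))
        |>.eventually_ge_atTop C] with n h1 h2 h3 h4 h5 h6 h7 h8
    have hn : (0 : ℝ) < n := Nat.cast_pos.2 h5
    have hl : 0 < Real.logb 2 n := by linarith
    have hq : (0 : ℝ) ≤ n / Real.logb 2 n := by positivity
    rw [Real.norm_of_nonneg hq, Real.norm_of_nonneg (Nat.cast_nonneg _)] at h2 h3
    have hA := cast_mul_log_le (n := n) (D := D) h1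
    set A := D * (Nat.log 2 n + 1) with hAdef
    have hA1 : 1 ≤ A := Nat.mul_pos hD1 (Nat.succ_pos _)
    rw [div_le_iff₀ hl] at h3
    refine ⟨h1, hn, by rwa [div_le_iff₀ hl], ?_, ?_, h4.trans (le_two_pow_log n D), ?_⟩
    · have : C' * Real.logb 2 n * 20 ≤ C' * Real.logb 2 n * k n := by linarith
      exact_mod_cast le_of_mul_le_mul_left this (by positivity)
    · have : (k n : ℝ) ≤ n := by
        refine h2.trans ?_
        rw [mul_div_assoc', div_le_iff₀ hl]
        have h8 : C ≤ Real.logb 2 n := h8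
        nlinarith
      exact_mod_cast this
    · have hA1' : (1 : ℝ) ≤ A := by exact_mod_cast hA1
      have h9 : (A : ℝ) * (4 * A + 10) ≤ 14 * (2 * D * Real.logb 2 n) ^ 2 := by
        have : (A : ℝ) ^ 2 ≤ (2 * D * Real.logb 2 n) ^ 2 := by gcongr
        nlinarith
      have h10 : C' * Real.logb 2 n * (A * (4 * A + 10)) ≤ C' * Real.logb 2 n * k n := by
        calc C' * Real.logb 2 n * (A * (4 * A + 10))
            ≤ C' * Real.logb 2 n * (14 * (2 * D * Real.logb 2 n) ^ 2) := by gcongr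
          _ = 56 * D ^ 2 * C' * Real.logb 2 n ^ 3 := by ring
          _ ≤ n := h7
          _ ≤ C' * k n * Real.logb 2 n := h3
          _ = _ := by ring
      exact_mod_cast le_of_mul_le_mul_left h10 (by positivity)
  constructor
  · refine ⟨16 * D * C', 2, ?_⟩
    filter_upwards [hbase, hle, hf] with n ⟨h1, hn, h3, h4, h5, h6, h7⟩ hnm hfn s hs
    have hA := cast_mul_log_le (n := n) (D := D) h1
    have hA0 : 0 < D * (Nat.log 2 n + 1) := Nat.mul_pos hD1 (Nat.succ_pos _)
    refine le_trans ?_ (hfn.two_probe_real (h5.trans hnm) hs h6 hA0 h4)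
    generalize D * (Nat.log 2 n + 1) = A at *
    have hl : 0 < Real.logb 2 n := by linarith
    have hk0 : (0 : ℝ) < k n := by exact_mod_cast (by omega : 0 < k n)
    have key : 8 * (A : ℝ) / k n ≤ 16 * D * C' * (1 / n * Real.logb 2 n ^ 2) := by
      rw [div_le_iff₀ hl] at h3
      rw [div_le_iff₀ hk0]
      calc 8 * (A : ℝ) ≤ 8 * (2 * D * Real.logb 2 n) := by gcongr
        _ = 16 * D * Real.logb 2 n * (n / n) := by
          rw [div_self hn.ne']
          ring
        _ ≤ 16 * D * Real.logb 2 n * (C' * k n * Real.logb 2 n / n) := by gcongr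
        _ = _ := by ring
    have := mul_le_mul_of_nonneg_left key (Nat.cast_nonneg (α := ℝ) (m n))
    have e : 16 * D * C' * ((m n : ℝ) / n * Real.logb 2 n ^ 2) =
        m n * (16 * D * C' * (1 / n * Real.logb 2 n ^ 2)) := by ring
    rw [e]
    linarith
  · refine ⟨1 / (168 * D * C'), by positivity, ?_⟩
    filter_upwards [hbase, hle, hf] with n ⟨h1, hn, h3, h4, h5, h6, h7⟩ hnm hfn t ht s hs
    have hA := cast_mul_log_le (n := n) (D := D) h1
    have hA0 : 0 < D * (Nat.log 2 n + 1) := Nat.mul_pos hD1 (Nat.succ_pos _)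
    refine le_trans ?_ (hfn.multi_probe_real (h5.trans hnm) hs ht h6 hA0 h7 h5 hnm)
    generalize D * (Nat.log 2 n + 1) = A at *
    have hA0' : (0 : ℝ) < A := Nat.cast_pos.2 hA0
    have hl : 0 < Real.logb 2 n := by linarith
    have hlm : Real.logb 2 n ≤ Real.logb 2 (m n) :=
      Real.logb_le_logb_of_le one_lt_two hn (by exact_mod_cast hnm)
    have hlm0 : 0 < Real.logb 2 (m n) := hl.trans_le hlm
    set X := ((m n : ℝ) / n) ^ (1 / ((t : ℝ) - 1)) with hX
    have hX0 : 0 ≤ X := by positivity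
    have hA' : (A : ℝ) ≤ 2 * D * Real.logb 2 (m n) := hA.trans (by gcongr)
    calc 1 / (168 * D * C') * (n * X * (1 / (2 ^ t * Real.logb 2 n * Real.logb 2 (m n))))
        = (n / Real.logb 2 n) / C' * X * (1 / (2 ^ t * (84 * (2 * D * Real.logb 2 (m n))))) := by
          field_simp
          ring
      _ ≤ k n * X * (1 / (2 ^ t * (84 * A))) := by
          gcongr
          rw [div_le_iff₀ hC'0]
          linarith

/-! ### Arithmetic in `K[X] / (X ^ N - a)` on numbers -/

section Encoding

/-- A fixed numbering of the elements of a finite field. -/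
noncomputable def fieldCode (K : Type*) [Fintype K] : K ≃ Fin (Fintype.card K) :=
  Fintype.equivFin K

/-- The digit of `x` at position `l` in base `|K|`, as an element of `K`. -/
noncomputable def fieldDigit (K : Type*) [Field K] [Fintype K] (x l : ℕ) : K :=
  (fieldCode K).symm ⟨x / Fintype.card K ^ l % Fintype.card K, Nat.mod_lt _ Fintype.card_pos⟩

/-- The number below `|K| ^ N` with given digits in base `|K|`. -/
noncomputable def encodeDigits {K : Type*} [Fintype K] (N : ℕ) (g : ℕ → K) : ℕ :=
  ∑ l ∈ Finset.range N, Fintype.card K ^ l * fieldCode K (g l)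

theorem encodeDigits_eq {K : Type*} [Fintype K] (N : ℕ) (g : ℕ → K) :
    encodeDigits N g = finFunctionFinEquiv fun l : Fin N => fieldCode K (g l) := by
  rw [finFunctionFinEquiv_apply, encodeDigits, Finset.sum_range]
  exact Finset.sum_congr rfl fun _ _ => mul_comm _ _

theorem encodeDigits_lt {K : Type*} [Fintype K] (N : ℕ) (g : ℕ → K) : encodeDigits N g < Fintype.card K ^ N := by
  rw [encodeDigits_eq]
  exact Fin.is_lt _

variable {K : Type*} [Field K]

theorem fieldDigit_eq [Fintype K] {N x l : ℕ} (hx : x < Fintype.card K ^ N) (hl : l < N) :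
    fieldDigit K x l = (fieldCode K).symm (finFunctionFinEquiv.symm ⟨x, hx⟩ ⟨l, hl⟩) := by
  rw [fieldDigit]
  congr 1

theorem fieldDigit_encodeDigits [Fintype K] {N l : ℕ} (g : ℕ → K) (hl : l < N) :
    fieldDigit K (encodeDigits N g) l = g l := by
  have : (⟨encodeDigits N g, encodeDigits_lt N g⟩ : Fin (Fintype.card K ^ N)) =
      finFunctionFinEquiv fun l : Fin N => fieldCode K (g l) := Fin.ext (encodeDigits_eq N g)
  rw [fieldDigit_eq (encodeDigits_lt N g) hl, this, Equiv.symm_apply_apply, Equiv.symm_apply_apply]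

theorem eq_of_fieldDigit_eq [Fintype K] {N x y : ℕ} (hx : x < Fintype.card K ^ N) (hy : y < Fintype.card K ^ N)
    (h : ∀ l < N, fieldDigit K x l = fieldDigit K y l) : x = y := by
  have : (⟨x, hx⟩ : Fin (Fintype.card K ^ N)) = ⟨y, hy⟩ := by
    refine finFunctionFinEquiv.symm.injective (funext fun l => ?_)
    have := h l l.2
    rw [fieldDigit_eq hx l.2, fieldDigit_eq hy l.2] at this
    exact (fieldCode K).symm.injective this
  exact congrArg Fin.val this

/-- The coefficients of a product modulo `X ^ N - a`. -/
def binomMul (N : ℕ) (a : K) (u v : ℕ → K) (l : ℕ) : K :=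
  ∑ s ∈ Finset.range N, u s * if s ≤ l then v (l - s) else a * v (l + N - s)

/-- Multiplication by `θ ^ s` rotates the coefficients, those that wrap around gaining the factor `a
= θ ^ N`. Irreducibility plays no role. -/
theorem sum_binomMul {L : Type*} [CommRing L] (φ : K →+* L) {N : ℕ} {a : K} {θ : L}
    (hθ : θ ^ N = φ a) (u v : ℕ → K) :
    ∑ l ∈ Finset.range N, φ (binomMul N a u v l) * θ ^ l =
      (∑ l ∈ Finset.range N, φ (u l) * θ ^ l) * ∑ l ∈ Finset.range N, φ (v l) * θ ^ l := by
  have key : ∀ s ∈ Finset.range N, ∑ l ∈ Finset.range N,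
      φ (if s ≤ l then v (l - s) else a * v (l + N - s)) * θ ^ l =
        θ ^ s * ∑ l ∈ Finset.range N, φ (v l) * θ ^ l := by
    intro s hs
    obtain ⟨d, rfl⟩ : ∃ d, N = s + d := ⟨N - s, by have := Finset.mem_range.1 hs; omega⟩
    rw [Finset.sum_range_add, add_comm s d, Finset.sum_range_add, mul_add, add_comm,
      Finset.mul_sum, Finset.mul_sum]
    congr 1
    · refine Finset.sum_congr rfl fun l _ => ?_
      rw [if_pos (Nat.le_add_right s l), Nat.add_sub_cancel_left, pow_add]
      ring
    · refine Finset.sum_congr rfl fun l hl => ?_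
      have hl := Finset.mem_range.1 hl
      rw [if_neg (by omega), map_mul, ← hθ, show l + (d + s) - s = d + l by omega]
      ring
  simp only [binomMul, map_sum, map_mul, Finset.sum_mul]
  rw [Finset.sum_comm]
  refine Finset.sum_congr rfl fun s hs => ?_
  simp only [mul_assoc, ← Finset.mul_sum]
  rw [key s hs]

/-- The code of the `j`-th power of the element with code `i` of `K[X] / (X ^ N - a)`. -/
noncomputable def powCode [Fintype K] (N : ℕ) (a : K) (i : ℕ) : ℕ → ℕ
  | 0 => encodeDigits N fun l => if l = 0 then (1 : K) else 0
  | j + 1 => encodeDigits N (binomMul N a (fieldDigit K (powCode N a i j)) (fieldDigit K i))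

theorem powCode_lt [Fintype K] (N : ℕ) (a : K) (i j : ℕ) : powCode N a i j < Fintype.card K ^ N := by
  cases j <;> exact encodeDigits_lt _ _

theorem sum_powCode [Fintype K] {L : Type*} [CommRing L] (φ : K →+* L) {N : ℕ} (hN : 0 < N) {a : K} {θ : L}
    (hθ : θ ^ N = φ a) (i j : ℕ) :
    ∑ l ∈ Finset.range N, φ (fieldDigit K (powCode N a i j) l) * θ ^ l =
      (∑ l ∈ Finset.range N, φ (fieldDigit K i l) * θ ^ l) ^ j := by
  induction j with
  | zero =>
    have : ∀ l ∈ Finset.range N, φ (fieldDigit K (powCode N a i 0) l) * θ ^ l =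
        if l = 0 then 1 else 0 := by
      intro l hl
      rw [powCode, fieldDigit_encodeDigits _ (Finset.mem_range.1 hl)]
      split_ifs with h <;> simp [h]
    rw [Finset.sum_congr rfl this]
    simp [hN]
  | succ j ih =>
    rw [pow_succ, ← ih, ← sum_binomMul φ hθ]
    refine Finset.sum_congr rfl fun l hl => ?_
    rw [powCode, fieldDigit_encodeDigits _ (Finset.mem_range.1 hl)]

end Encoding

/-! ### Generalized Vandermonde codes -/

theorem eq_zero_of_forall_sum_mul_pow_eq_zero {L ι : Type*} [Field L] [Fintype ι]
    [DecidableEq L] {α γ : ι → L} (hα : Function.Injective α) {k : ℕ}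
    (h : ∀ j < k, ∑ i, γ i * α i ^ j = 0)
    (hk : (Finset.univ.filter fun i => γ i ≠ 0).card ≤ k) : γ = 0 := by
  classical
  by_contra hγ
  obtain ⟨i₀, hi₀⟩ := Function.ne_iff.1 hγ
  set Z := Finset.univ.filter fun i => γ i ≠ 0 with hZ
  have hmem : i₀ ∈ Z := by simpa [hZ] using hi₀
  -- `g` vanishes on the support of `γ` except at `i₀`, and has degree below `k`; combining the
  -- power sums with its coefficients isolates `γ i₀`.
  set g : Polynomial L := ∏ i ∈ Z.erase i₀, (Polynomial.X - Polynomial.C (α i)) with hg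
  have hdeg : g.natDegree < k := by
    rw [hg, Polynomial.natDegree_finsetProd_X_sub_C_eq_card, Finset.card_erase_of_mem hmem]
    have := Finset.card_pos.2 ⟨i₀, hmem⟩
    omega
  have h1 : ∑ i, γ i * g.eval (α i) = 0 := by
    simp only [Polynomial.eval_eq_sum_range, Finset.mul_sum]
    rw [Finset.sum_comm]
    refine Finset.sum_eq_zero fun j hj => ?_
    have := h j ((Nat.lt_succ_iff.1 (Finset.mem_range.1 hj)).trans_lt hdeg)
    calc ∑ i, γ i * (g.coeff j * α i ^ j) = g.coeff j * ∑ i, γ i * α i ^ j := by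
          rw [Finset.mul_sum]
          exact Finset.sum_congr rfl fun _ _ => by ring
      _ = 0 := by rw [this, mul_zero]
  have h2 : ∑ i, γ i * g.eval (α i) = γ i₀ * g.eval (α i₀) := by
    refine Finset.sum_eq_single i₀ (fun i _ hi => ?_) (by simp)
    by_cases hγi : γ i = 0
    · rw [hγi, zero_mul]
    · have : i ∈ Z.erase i₀ := by simp [hZ, hi, hγi]
      rw [hg, Polynomial.eval_prod, Finset.prod_eq_zero this (by simp), mul_zero]
  rw [h1] at h2
  refine mul_ne_zero hi₀ ?_ h2.symm
  rw [hg, Polynomial.eval_prod, Finset.prod_ne_zero_iff]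
  intro i hi
  simpa [sub_eq_zero] using fun h => (Finset.ne_of_mem_erase hi) (hα h).symm

section Code

variable (F : Type*) {K : Type*} [Field F] [Field K] [Fintype K] [Algebra F K]
  [FiniteDimensional F K]

/-- Entry `(ρ, i)` of the parity-check matrix: the coordinates over `F` of the powers of the
element with code `i`. -/
noncomputable def codeEntry (N : ℕ) (a : K) (ρ i : ℕ) : F :=
  (Module.finBasis F K).repr
    (fieldDigit K (powCode N a i (ρ / (Module.finrank F K * N))) (ρ / Module.finrank F K % N))
    ⟨ρ % Module.finrank F K, Nat.mod_lt _ Module.finrank_pos⟩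

variable {F}

/-- A row number encodes the exponent `j`, the position `l` of a coefficient over `K`, and the
coordinate `u` over `F`. -/
theorem mixed_radix_digits (j : ℕ) {l N u d : ℕ} (hl : l < N) (hu : u < d) :
    ((j * N + l) * d + u) % d = u ∧ ((j * N + l) * d + u) / d % N = l ∧
      ((j * N + l) * d + u) / (d * N) = j := by
  have e : ((j * N + l) * d + u) / d = j * N + l := by
    rw [Nat.add_comm, Nat.add_mul_div_right _ _ (by omega), Nat.div_eq_of_lt hu, zero_add]
  refine ⟨?_, ?_, ?_⟩
  · rw [Nat.add_comm, Nat.add_mul_mod_self_right, Nat.mod_eq_of_lt hu]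
  · rw [e, Nat.add_comm, Nat.add_mul_mod_self_right, Nat.mod_eq_of_lt hl]
  · rw [← Nat.div_div_eq_div_mul, e, Nat.add_comm, Nat.add_mul_div_right _ _ (by omega),
      Nat.div_eq_of_lt hl, zero_add]

/-- Vectors of small weight are not in the kernel of the matrix. -/
theorem eq_zero_of_codeEntry [DecidableEq F] {N n m k : ℕ} {a : K}
    (hirr : Irreducible (Polynomial.X ^ N - Polynomial.C a : Polynomial K)) (hN : 0 < N)
    (hm : m ≤ Fintype.card K ^ N) (hk : k * (Module.finrank F K * N) ≤ n) {c : Fin m → F}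
    (hc : ∀ ρ < n, ∑ i : Fin m, codeEntry F N a ρ i * c i = 0) (hw : hammingNorm c ≤ k) :
    c = 0 := by
  classical
  have : Fact (Irreducible (Polynomial.X ^ N - Polynomial.C a : Polynomial K)) := ⟨hirr⟩
  set L := AdjoinRoot (Polynomial.X ^ N - Polynomial.C a : Polynomial K) with hL
  set θ : L := AdjoinRoot.root _ with hθdef
  set φ : K →+* L := AdjoinRoot.of _ with hφ
  have hθ : θ ^ N = φ a := by
    have := AdjoinRoot.eval₂_root (Polynomial.X ^ N - Polynomial.C a : Polynomial K)
    rw [Polynomial.eval₂_sub, Polynomial.eval₂_pow, Polynomial.eval₂_X, Polynomial.eval₂_C,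
      sub_eq_zero] at this
    exact this
  -- The powers of `θ` below `N` are independent over `K`; hence distinct codes give distinct
  -- elements of `L`.
  have hindep : ∀ u : ℕ → K, ∑ l ∈ Finset.range N, φ (u l) * θ ^ l = 0 → ∀ l < N, u l = 0 := by
    intro u hu l hl
    set p : Polynomial K := ∑ l : Fin N, Polynomial.C (u l) * Polynomial.X ^ (l : ℕ) with hp
    have hmk : AdjoinRoot.mk (Polynomial.X ^ N - Polynomial.C a : Polynomial K) p = 0 := by
      rw [hp, map_sum, ← hu, Finset.sum_range]
      simp [hφ, hθdef]
    rw [AdjoinRoot.mk_eq_zero] at hmk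
    have hp0 : p = 0 := by
      refine Polynomial.eq_zero_of_dvd_of_degree_lt hmk ?_
      rw [Polynomial.degree_X_pow_sub_C hN]
      exact Polynomial.degree_sum_fin_lt _
    have := congrArg (fun q => Polynomial.coeff q l) hp0
    simp only [hp, Polynomial.finsetSum_coeff, Polynomial.coeff_C_mul_X_pow,
      Polynomial.coeff_zero] at this
    rw [Finset.sum_eq_single ⟨l, hl⟩] at this
    · simpa using this
    · intro b _ hb
      rw [if_neg]
      rintro rfl
      exact hb rfl
    · simp
  set α : Fin m → L := fun i => ∑ l ∈ Finset.range N, φ (fieldDigit K i l) * θ ^ l with hα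
  have hαinj : Function.Injective α := by
    intro i i' h
    refine Fin.ext (eq_of_fieldDigit_eq (K := K) (i.2.trans_le hm) (i'.2.trans_le hm) ?_)
    intro l hl
    refine sub_eq_zero.1 (hindep (fun l => fieldDigit K i l - fieldDigit K i' l) ?_ l hl)
    simp only [map_sub, sub_mul, Finset.sum_sub_distrib]
    exact sub_eq_zero.2 h
  -- The `F`-coordinates combine to equations in `K`, and these to the power sums in `L`. Rows
  -- beyond `k * (d * N)`, where `d = [K : F]`, are not needed.
  have hK : ∀ j < k, ∀ l < N,
      ∑ i, algebraMap F K (c i) * fieldDigit K (powCode N a i j) l = 0 := by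
    intro j hj l hl
    refine (Module.finBasis F K).ext_elem fun u => ?_
    have hρ : (j * N + l) * Module.finrank F K + u < n := by
      refine lt_of_lt_of_le ?_ hk
      have h1 : j * N + l + 1 ≤ k * N := by
        have : (j + 1) * N ≤ k * N := Nat.mul_le_mul_right N hj
        nlinarith
      have h2 := Nat.mul_le_mul_right (Module.finrank F K) h1
      have := u.2
      nlinarith
    obtain ⟨e1, e2, e3⟩ := mixed_radix_digits j hl u.2
    have := hc _ hρ
    simp only [codeEntry, e1, e2, e3] at this
    simp only [← Algebra.smul_def, map_sum, map_smul, Finsupp.coe_finsetSum, Finset.sum_apply,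
      Finsupp.smul_apply, smul_eq_mul, map_zero, Finsupp.zero_apply]
    rw [← this]
    exact Finset.sum_congr rfl fun i _ => mul_comm _ _
  have hpow : ∀ j < k, ∑ i, φ (algebraMap F K (c i)) * α i ^ j = 0 := by
    intro j hj
    have h1 : ∀ i, φ (algebraMap F K (c i)) * α i ^ j = ∑ l ∈ Finset.range N,
        φ (algebraMap F K (c i) * fieldDigit K (powCode N a i j) l) * θ ^ l := by
      intro i
      rw [hα, ← sum_powCode φ hN hθ, Finset.mul_sum]
      exact Finset.sum_congr rfl fun l _ => by rw [map_mul, mul_assoc]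
    simp only [h1]
    rw [Finset.sum_comm]
    refine Finset.sum_eq_zero fun l hl => ?_
    rw [← Finset.sum_mul, ← map_sum, hK j hj l (Finset.mem_range.1 hl), map_zero, zero_mul]
  have hzero : ∀ i, φ (algebraMap F K (c i)) = 0 ↔ c i = 0 := fun i => by
    rw [map_eq_zero, map_eq_zero]
  have := eq_zero_of_forall_sum_mul_pow_eq_zero (γ := fun i => φ (algebraMap F K (c i))) hαinj hpow
    (by simpa only [ne_eq, hzero, hammingNorm] using hw)
  exact funext fun i => (hzero i).1 (congrFun this i)

end Code

/-! ### From distance to independence -/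

/-- Translation by a preimage of `y` carries the fibre over 0 to the fibre over `y`, so all fibres
have equal mass. -/
theorem PMF.map_uniformOfFintype_of_surjective {A B : Type*} [AddGroup A] [AddGroup B] [Fintype A]
    [Fintype B] (g : A →+ B) (hg : Function.Surjective g) :
    (PMF.uniformOfFintype A).map g = PMF.uniformOfFintype B := by
  classical
  have hconst : ∀ y, (PMF.uniformOfFintype A).map g y = (PMF.uniformOfFintype A).map g 0 := by
    intro y
    obtain ⟨x, rfl⟩ := hg y
    rw [PMF.map_apply, PMF.map_apply, ← (Equiv.addLeft x).tsum_eq]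
    refine tsum_congr fun z => ?_
    simp [PMF.uniformOfFintype_apply, eq_comm]
  ext y
  have hsum := ((PMF.uniformOfFintype A).map g).tsum_coe
  rw [tsum_fintype, Finset.sum_congr rfl fun z _ => hconst z, Finset.sum_const, nsmul_eq_mul] at hsum
  rw [hconst, PMF.uniformOfFintype_apply]
  exact ENNReal.eq_inv_of_mul_eq_one_left (by rwa [mul_comm])

theorem Matrix.vecMul_surjective_of_mulVec_injective {F ι κ : Type*} [Field F] [Fintype ι]
    [Fintype κ] (M : Matrix ι κ F) (h : Function.Injective M.mulVec) :
    Function.Surjective fun x => Matrix.vecMul x M := by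
  classical
  have h1 : M.rank = Fintype.card κ := by
    rw [Matrix.rank, LinearMap.finrank_range_of_inj (f := M.mulVecLin) h, Module.finrank_fintype_fun_eq_card]
  rw [← Matrix.rank_transpose, Matrix.rank] at h1
  have h2 : LinearMap.range M.transpose.mulVecLin = ⊤ := by
    apply Submodule.eq_top_of_finrank_eq
    rw [h1, Module.finrank_fintype_fun_eq_card]
  intro y
  obtain ⟨x, hx⟩ := LinearMap.range_eq_top.1 h2 y
  exact ⟨x, by simpa [Matrix.mulVec_transpose] using hx⟩

/-- A dependency among the columns in `S`, extended by zero, is a kernel vector of weight at most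
`k`. So these columns are independent and the outputs in `S` are a surjective linear image. -/
theorem kWiseIndependent_vecMul {F : Type*} [Field F] [Fintype F] [DecidableEq F] {n m k : ℕ}
    (M : Matrix (Fin n) (Fin m) F)
    (h : ∀ c : Fin m → F, c ≠ 0 → M.mulVec c = 0 → k < hammingNorm c) :
    KWiseIndependent k fun x => Matrix.vecMul x M := by
  classical
  intro S hS
  let B : Matrix (Fin n) S F := M.submatrix id Subtype.val
  have hB : Function.Injective B.mulVec := by
    change Function.Injective B.mulVecLin
    rw [← LinearMap.ker_eq_bot, LinearMap.ker_eq_bot']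
    intro c hc
    by_contra hne
    let c' : Fin m → F := fun i => if hi : i ∈ S then c ⟨i, hi⟩ else 0
    have hcc' : ∀ i : S, c' i = c i := fun i => by simp [c']
    have h1 : M.mulVec c' = 0 := by
      rw [← hc]
      ext ρ
      simp only [Matrix.mulVecLin_apply, Matrix.mulVec, dotProduct]
      rw [← Finset.sum_subset (Finset.subset_univ S), ← Finset.sum_coe_sort S]
      · exact Finset.sum_congr rfl fun i _ => by rw [hcc']; rfl
      · intro i _ hi
        simp [c', hi]
    have h2 : c' ≠ 0 := by
      intro h0
      exact hne (funext fun i => by rw [← hcc', h0]; rfl)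
    have h3 : hammingNorm c' ≤ S.card := by
      refine Finset.card_le_card fun i hi => ?_
      by_contra hiS
      simp [c', hiS] at hi
    have := h c' h2 h1
    omega
  have hsurj := Matrix.vecMul_surjective_of_mulVec_injective B hB
  exact PMF.map_uniformOfFintype_of_surjective (B.vecMulLinear : (Fin n → F) →+ (S → F)) hsurj

/-! ### Explicitness -/

namespace PolyTime

variable {α : Type*} {mem : α → ℕ → ℕ} {size : α → ℕ} {Γ : Set (α → ℕ)} {K : Type*} [Fintype K]

theorem fieldDigit [Field K] {x l : α → ℕ} (hx : PolyTime mem size Γ x) (hxb : PolyBdd size x)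
    (hl : PolyTime mem size Γ l) (hlb : PolyBdd size l) :
    PolyTime mem size Γ fun a => fieldCode K (fieldDigit K (x a) (l a)) := by
  simp only [_root_.fieldDigit, Equiv.apply_symm_apply]
  exact (hx.div hxb (const_pow _ hl hlb) fun _ => pow_pos Fintype.card_pos _).mod
    (hxb.mono fun _ => Nat.div_le_self _ _) (const _) fun _ => Fintype.card_pos

theorem encodeDigits {N : α → ℕ} (hN : PolyTime mem size Γ N) (hNb : PolyBdd size N)
    {g : α × ℕ → K} (hg : PolyTime (fun p : α × ℕ => mem p.1) (fun p => size p.1 + p.2)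
      (loopCtx Γ) fun p => fieldCode K (g p)) :
    PolyTime mem size Γ fun a => encodeDigits (N a) fun l => g (a, l) :=
  sum ((const_pow _ index .index).mul hg ((PolyBdd.const (Fintype.card K)).mono
    fun p => (fieldCode K (g p)).2.le)) hN hNb

theorem binomMul [Field K] (c : K) {N x y l : α → ℕ} (hN : PolyTime mem size Γ N) (hNb : PolyBdd size N)
    (hx : PolyTime mem size Γ x) (hxb : PolyBdd size x) (hy : PolyTime mem size Γ y)
    (hyb : PolyBdd size y) (hl : PolyTime mem size Γ l) (hlb : PolyBdd size l) :
    PolyTime mem size Γ fun a => fieldCode K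
      (binomMul (N a) c (_root_.fieldDigit K (x a)) (_root_.fieldDigit K (y a)) (l a)) := by
  refine sum_monoid (x := fun p : α × ℕ => _root_.fieldDigit K (x p.1) p.2 *
    if p.2 ≤ l p.1 then _root_.fieldDigit K (y p.1) (l p.1 - p.2)
      else c * _root_.fieldDigit K (y p.1) (l p.1 + N p.1 - p.2)) ?_ hN hNb
  refine map₂ (eB := fieldCode K) (fun z => (fieldCode K z : ℕ)) (· * ·) (fieldDigit hx.lift hxb.lift index .index) ?_
  simp only [apply_ite (fieldCode K), apply_ite Fin.val]
  refine ite_le index hl.lift (fieldDigit hy.lift hyb.lift (hl.lift.sub index)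
    (hlb.lift.mono fun _ => Nat.sub_le _ _)) ?_
  exact map₂ (eA := fieldCode K) (fun z => (fieldCode K z : ℕ)) (· * ·) (const _) (fieldDigit hy.lift hyb.lift
    ((hl.lift.add hN.lift).sub index) ((hlb.lift.add hNb.lift).mono fun _ => Nat.sub_le _ _))

/-- The bound on `|K| ^ N` keeps all intermediate codes polynomial, so that digits can be extracted
by counting. -/
theorem powCode [Field K] (c : K) {N x j : α → ℕ} (hN : PolyTime mem size Γ N) (hNb : PolyBdd size N)
    (hQb : PolyBdd size fun a => Fintype.card K ^ N a)
    (hx : PolyTime mem size Γ x) (hxb : PolyBdd size x)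
    (hj : PolyTime mem size Γ j) (hjb : PolyBdd size j) :
    PolyTime mem size Γ fun a => powCode (N a) c (x a) (j a) := by
  refine loop (acc := fun p : α × ℕ => _root_.powCode (N p.1) c (x p.1) p.2) ?_ hj hjb ?_
  · simp only [_root_.powCode]
    refine encodeDigits (g := fun p => if p.2 = 0 then 1 else 0) hN hNb ?_
    simp only [apply_ite (fieldCode K), apply_ite Fin.val]
    exact index.ite_eq_zero (const _) (const _)
  · simp only [_root_.powCode]
    have hmono := Set.subset_insert (fun p : α × ℕ => _root_.powCode (N p.1) c (x p.1) p.2)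
      (loopCtx Γ)
    have hacc : PolyTime (fun p : α × ℕ => mem p.1) (fun p => size p.1 + p.2)
        (insert (fun p : α × ℕ => _root_.powCode (N p.1) c (x p.1) p.2) (loopCtx Γ))
        fun p => _root_.powCode (N p.1) c (x p.1) p.2 := var (Set.mem_insert _ _)
    refine encodeDigits (g := fun p : (α × ℕ) × ℕ => _root_.binomMul (N p.1.1) c
      (_root_.fieldDigit K (_root_.powCode (N p.1.1) c (x p.1.1) p.1.2))
      (_root_.fieldDigit K (x p.1.1)) p.2) (hN.lift.mono hmono) hNb.lift ?_
    exact binomMul c (hN.lift.mono hmono).lift hNb.lift.lift hacc.lift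
      (hQb.lift.lift.mono fun _ => (powCode_lt _ _ _ _).le) (hx.lift.mono hmono).lift hxb.lift.lift
      (index (mem := fun p : α × ℕ => mem p.1) (size := fun p : α × ℕ => size p.1 + p.2))
      (PolyBdd.index (size := fun p : α × ℕ => size p.1 + p.2))

theorem codeEntry [Field K] {F : Type*} [Field F] [Fintype F] [Algebra F K] [FiniteDimensional F K] (c : K)
    {N ρ x : α → ℕ} (hN0 : ∀ a, 0 < N a) (hN : PolyTime mem size Γ N) (hNb : PolyBdd size N)
    (hQb : PolyBdd size fun a => Fintype.card K ^ N a)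
    (hρ : PolyTime mem size Γ ρ) (hρb : PolyBdd size ρ)
    (hx : PolyTime mem size Γ x) (hxb : PolyBdd size x) :
    PolyTime mem size Γ fun a => fieldCode F (codeEntry F (N a) c (ρ a) (x a)) := by
  have hd : 0 < Module.finrank F K := Module.finrank_pos
  refine map₂ (eB := Equiv.refl (Fin (Module.finrank F K))) (fun z => (fieldCode F z : ℕ))
    (fun z u => (Module.finBasis F K).repr z u)
    (fieldDigit (powCode c hN hNb hQb hx hxb
      (hρ.div hρb ((const (Module.finrank F K)).mul hN hNb) fun a => Nat.mul_pos hd (hN0 a))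
      (hρb.mono fun _ => Nat.div_le_self _ _)) (hQb.mono fun _ => (powCode_lt _ _ _ _).le)
      ((hρ.div hρb (const _) fun _ => hd).mod (hρb.mono fun _ => Nat.div_le_self _ _) hN hN0)
      (hρb.mono fun _ => (Nat.mod_le _ _).trans (Nat.div_le_self _ _))) ?_
  exact hρ.mod hρb (const _) fun _ => hd

end PolyTime

/-- A family computed by a `PolyTime` function of `n`, `i` and the input is explicit. -/
theorem isExplicit_of_polyTime {F : Type*} [Fintype F] {m : ℕ → ℕ}
    {f : (n : ℕ) → (Fin n → F) → Fin (m n) → F} (e : F ≃ Fin (Fintype.card F))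
    (h : PolyTime (α := Σ n, (Fin n → F) × Fin (m n))
      (fun a => (RAMInput a.1 a.2.2 fun j => e (a.2.1 j)).mem) (fun a => a.1)
      {fun a => a.1, fun a => (a.2.2 : ℕ)} fun a => e (f a.1 a.2.1 a.2.2)) : IsExplicit f := by
  classical
  obtain ⟨p, B, ⟨P, hP⟩, hp⟩ := h (fun g => if g = fun a => a.1 then 0 else 1) 2 (by
    intro g _
    split_ifs <;> omega)
  refine ⟨e, .seq p (.seq (.const 1 0) (.add 0 2 1)), P + 2, fun n x i => ?_⟩
  obtain ⟨T, τ, hT, hTB, -, -, hr⟩ := hp ⟨n, x, i⟩ (RAMInput n i fun j => e (x j)) rfl (by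
    intro g hg
    by_cases h0 : g = fun a => a.1
    · simp [h0, RAMInput]
    · have h1 : g = fun a => (a.2.2 : ℕ) := by simpa [h0] using hg
      rw [if_neg h0, h1]
      simp [RAMInput])
  refine ⟨_, _, .seq hT (.seq (.const _ _ _) (.add _ _ _ _)), ?_, ?_⟩
  · have := hTB.trans (hP ⟨n, x, i⟩)
    simpa using this
  · simpa using hr

/-! ### The extension degree and explicitness of the matrix -/

/-- The degree of the field extension used for inputs of length `n`. -/
def extDegree (q J n : ℕ) : ℕ := q ^ (J + 1 + Nat.log q (Nat.log 2 n))

theorem extDegree_pos {q : ℕ} (hq : 1 < q) (J n : ℕ) : 0 < extDegree q J n :=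
  pow_pos (Nat.zero_lt_of_lt hq) _

/-- Rounding the logarithm up to a power of `q`, as irreducibility requires, keeps the degree of
order `log n`. -/
theorem le_extDegree {q : ℕ} (hq : 1 < q) (J n : ℕ) :
    q ^ J * (Nat.log 2 n + 1) ≤ extDegree q J n := by
  rw [extDegree, add_assoc, pow_add, add_comm 1]
  exact Nat.mul_le_mul_left _ (Nat.lt_pow_succ_log_self hq _)

theorem extDegree_le (q J n : ℕ) :
    extDegree q J n ≤ q ^ (J + 1) * (Nat.log 2 n + 1) := by
  rw [extDegree, pow_add _ (J + 1)]
  refine Nat.mul_le_mul_left _ ?_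
  rcases Nat.eq_zero_or_pos (Nat.log 2 n) with h | h
  · simp [h]
  · exact (Nat.pow_log_le_self q h.ne').trans (Nat.le_succ _)

theorem polyBdd_extDegree {α : Type*} {size : α → ℕ} (q J : ℕ) :
    PolyBdd size fun a => extDegree q J (size a) :=
  ((PolyBdd.const (q ^ (J + 1))).mul (PolyBdd.self.add (.const 1))).mono fun _ =>
    (extDegree_le q J _).trans (Nat.mul_le_mul_left _ (Nat.succ_le_succ (Nat.log_le_self _ _)))

theorem polyBdd_pow_extDegree {α : Type*} {size : α → ℕ} (q J Q : ℕ) :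
    PolyBdd size fun a => Q ^ extDegree q J (size a) := by
  refine (((PolyBdd.const 2).mul (PolyBdd.self.add (.const 1))).pow (Q * q ^ (J + 1))).mono ?_
  intro a
  have h1 : 2 ^ (Nat.log 2 (size a) + 1) ≤ 2 * (size a + 1) := by
    rw [pow_succ']
    refine Nat.mul_le_mul_left 2 ?_
    rcases Nat.eq_zero_or_pos (size a) with h | h
    · simp [h]
    · exact (Nat.pow_log_le_self 2 h.ne').trans (Nat.le_succ _)
  calc Q ^ extDegree q J (size a) ≤ (2 ^ Q) ^ extDegree q J (size a) :=
        Nat.pow_le_pow_left Nat.lt_two_pow_self.le _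
    _ ≤ (2 ^ Q) ^ (q ^ (J + 1) * (Nat.log 2 (size a) + 1)) :=
        Nat.pow_le_pow_right (by positivity) (extDegree_le q J _)
    _ = (2 ^ (Nat.log 2 (size a) + 1)) ^ (Q * q ^ (J + 1)) := by
        rw [← pow_mul, ← pow_mul]
        ring
    _ ≤ _ := Nat.pow_le_pow_left h1 _

theorem isExplicit_code {F K : Type*} [Field F] [Fintype F] [Field K] [Fintype K] [Algebra F K]
    [FiniteDimensional F K] {m : ℕ → ℕ} (hpoly : ∃ P : Polynomial ℕ, ∀ n, m n ≤ P.eval n) {q : ℕ}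
    (hq : 1 < q) (J : ℕ) (c : K) :
    IsExplicit fun n x => Matrix.vecMul x
      (Matrix.of fun (ρ : Fin n) (i : Fin (m n)) => codeEntry F (extDegree q J n) c ρ i) := by
  refine isExplicit_of_polyTime (fieldCode F) ?_
  set α := Σ n, (Fin n → F) × Fin (m n)
  set mem : α → ℕ → ℕ := fun a => (RAMInput a.1 a.2.2 fun j => fieldCode F (a.2.1 j)).mem
  set size : α → ℕ := fun a => a.1
  set Γ : Set (α → ℕ) := {fun a => a.1, fun a => (a.2.2 : ℕ)}
  have hn : PolyTime mem size Γ fun a => a.1 := .var (by simp [Γ])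
  have hi : PolyTime mem size Γ fun a => (a.2.2 : ℕ) := .var (by simp [Γ])
  have hib : PolyBdd size fun a => (a.2.2 : ℕ) := by
    obtain ⟨P, hP⟩ := hpoly
    exact ⟨P, fun a => a.2.2.2.le.trans (hP a.1)⟩
  have hnb : PolyBdd size fun a => a.1 := PolyBdd.self
  have hlog := hn.log one_lt_two hnb
  have hlogb : PolyBdd size fun a => Nat.log 2 a.1 := hnb.mono fun _ => Nat.log_le_self _ _
  have hN : PolyTime mem size Γ fun a => extDegree q J a.1 :=
    .const_pow q ((PolyTime.const (J + 1)).add (hlog.log hq hlogb))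
      ((PolyBdd.const (J + 1)).add (hlogb.mono fun _ => Nat.log_le_self _ _))
  have hNb : PolyBdd size fun a => extDegree q J a.1 := polyBdd_extDegree q J
  have hQb : PolyBdd size fun a => Fintype.card K ^ extDegree q J a.1 :=
    polyBdd_pow_extDegree q J _
  -- The default has code 0, the content of memory outside the input.
  let y : α × ℕ → F := fun p => if h : p.2 < p.1.1 then p.1.2.1 ⟨p.2, h⟩ else
    (fieldCode F).symm ⟨0, Fintype.card_pos⟩
  have hy : PolyTime (fun p : α × ℕ => mem p.1) (fun p => size p.1 + p.2) (loopCtx Γ)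
      fun p => fieldCode F (y p) := by
    have := PolyTime.load (mem := fun p : α × ℕ => mem p.1) (size := fun p => size p.1 + p.2)
      (Γ := loopCtx Γ) PolyTime.index
    convert this using 2 with p
    by_cases h : p.2 < p.1.1
    · simp [y, mem, RAMInput, h]
    · simp [y, mem, RAMInput, h]
  have hsum := PolyTime.sum_monoid (eA := fieldCode F)
    (x := fun p : α × ℕ => y p * codeEntry F (extDegree q J p.1.1) c p.2 p.1.2.2)
    (PolyTime.map₂ (fun z => (fieldCode F z : ℕ)) (· * ·) hy
      (.codeEntry c (fun _ => extDegree_pos hq _ _) hN.lift hNb.lift hQb.lift .index .index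
        hi.lift hib.lift)) hn hnb
  convert hsum using 4 with a
  simp only [Matrix.vecMul, dotProduct, Matrix.of_apply, Finset.sum_range]
  exact Finset.sum_congr rfl fun ρ _ => by simp [y]

/-! ### The main theorem -/

/-- Every finite field has a finite extension with an element that is not a `q`-th power,
for some odd prime `q`. -/
theorem exists_extension_not_pow.{u} (F : Type u) [Field F] [Finite F] :
    ∃ (q : ℕ) (K : Type u) (_ : Field K) (_ : Fintype K) (_ : Algebra F K) (a : K),
      q.Prime ∧ q ≠ 2 ∧ ∀ b : K, b ^ q ≠ a := by
  -- 3 works unless the characteristic is 3, and then 5 does.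
  obtain ⟨q, hq, hq2, hqF⟩ : ∃ q : ℕ, q.Prime ∧ q ≠ 2 ∧ (q : F) ≠ 0 := by
    by_cases h3 : ((3 : ℕ) : F) = 0
    · refine ⟨5, Nat.prime_five, by norm_num, fun h5 => one_ne_zero (α := F) ?_⟩
      push_cast at h3 h5
      linear_combination 2 * h3 - h5
    · exact ⟨3, Nat.prime_three, by norm_num, h3⟩
  have : NeZero (q : F) := ⟨hqF⟩
  have : NeZero q := ⟨hq.ne_zero⟩
  have : FiniteDimensional F (CyclotomicField q F) :=
    IsCyclotomicExtension.finiteDimensional {q} F (CyclotomicField q F)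
  have : Finite (CyclotomicField q F) := Module.finite_of_finite F
  have hζ := IsCyclotomicExtension.zeta_spec q F (CyclotomicField q F)
  -- A primitive `q`-th root of unity and 1 have the same `q`-th power, so on this finite field the
  -- power map is not injective, hence not surjective.
  obtain ⟨a, ha⟩ : ∃ a : CyclotomicField q F, ∀ b, b ^ q ≠ a := by
    by_contra! hsurj
    have hinj := Finite.injective_iff_surjective.2
      (show Function.Surjective fun b : CyclotomicField q F => b ^ q from hsurj)
    refine hζ.ne_one hq.one_lt (hinj ?_)
    simp [hζ.pow_eq_one]
  exact ⟨q, CyclotomicField q F, inferInstance, Fintype.ofFinite _, inferInstance, a, hq, hq2, ha⟩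

theorem isTheta_div_extDegree {q : ℕ} (hq : 1 < q) (J : ℕ) {d : ℕ} (hd : 0 < d) :
    (fun n => ((n / (d * extDegree q J n) : ℕ) : ℝ)) =Θ[atTop]
      (fun n : ℕ => (n : ℝ) / Real.logb 2 n) := by
  set E : ℝ := d * (q ^ (J + 1) : ℕ) with hE
  have hE0 : 0 < E := by
    have : 0 < q ^ (J + 1) := pow_pos (by omega) _
    positivity
  constructor
  · refine IsBigO.of_bound 1 ?_
    filter_upwards [eventually_one_le_logb] with n h1
    have hl : 0 < Real.logb 2 n := by linarith
    rw [Real.norm_of_nonneg (Nat.cast_nonneg _), Real.norm_of_nonneg (by positivity), one_mul]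
    refine Nat.cast_div_le.trans ?_
    refine div_le_div_of_nonneg_left (Nat.cast_nonneg n) hl ?_
    have h2 : Nat.log 2 n + 1 ≤ d * extDegree q J n :=
      ((Nat.le_mul_of_pos_left _ (pow_pos (by omega) J)).trans (le_extDegree hq J n)).trans
        (Nat.le_mul_of_pos_left _ hd)
    have h3 : Real.logb 2 n ≤ (Nat.log 2 n + 1 : ℕ) := by
      rcases Nat.eq_zero_or_pos n with rfl | hn
      · simp
      rw [Real.logb_le_iff_le_rpow one_lt_two (by positivity), Real.rpow_natCast]
      exact_mod_cast (Nat.lt_pow_succ_log_self one_lt_two n).le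
    exact h3.trans (Nat.cast_le.2 h2)
  · refine IsBigO.of_bound (4 * E) ?_
    filter_upwards [eventually_one_le_logb, eventually_mul_logb_pow_le (4 * E) 1] with n h1 h2
    have hl : 0 < Real.logb 2 n := by linarith
    rw [Real.norm_of_nonneg (by positivity), Real.norm_of_nonneg (Nat.cast_nonneg _)]
    have hN : 0 < d * extDegree q J n := Nat.mul_pos hd (extDegree_pos hq J n)
    have h3 : ((d * extDegree q J n : ℕ) : ℝ) ≤ 2 * E * Real.logb 2 n := by
      have h4 := Nat.mul_le_mul_left d (extDegree_le q J n)
      rw [← mul_assoc] at h4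
      have h5 := cast_mul_log_le (n := n) (D := d * q ^ (J + 1)) h1
      refine (Nat.cast_le.2 h4).trans (h5.trans_eq ?_)
      rw [hE]
      push_cast
      ring
    have h6 : (n : ℝ) ≤ ((n / (d * extDegree q J n) : ℕ) + 1) * (d * extDegree q J n : ℕ) := by
      have := (Nat.lt_div_mul_add (a := n) hN).le
      have h7 : n / (d * extDegree q J n) * (d * extDegree q J n) + d * extDegree q J n =
        (n / (d * extDegree q J n) + 1) * (d * extDegree q J n) := by ring
      rw [h7] at this
      exact_mod_cast this
    generalize d * extDegree q J n = N at *
    generalize ((n / N : ℕ) : ℝ) = z at *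
    rw [div_le_iff₀ hl]
    have hz : 0 ≤ z + 1 := by
      by_contra hneg
      have : (0 : ℝ) ≤ N := Nat.cast_nonneg N
      have : (0 : ℝ) < n := by nlinarith
      nlinarith
    have h8 := mul_le_mul_of_nonneg_left h3 hz
    nlinarith

theorem theorem1 {F : Type*} [Field F] [Fintype F] [DecidableEq F] (m : ℕ → ℕ)
    (hpoly : ∃ P : Polynomial ℕ, ∀ n, m n ≤ P.eval n)
    (hle : ∀ᶠ n in atTop, n ≤ m n) :
    -- an explicit problem, namely multiplication by parity-check matrices of codes of distance `> k`
    (∃ (k : ℕ → ℕ) (M : (n : ℕ) → Matrix (Fin n) (Fin (m n)) F),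
      (fun n => (k n : ℝ)) =Θ[atTop] (fun n : ℕ => (n : ℝ) / Real.logb 2 n) ∧
      IsExplicit (fun n x => Matrix.vecMul x (M n)) ∧
      (∀ᶠ n in atTop, KWiseIndependent (k n) (fun x => Matrix.vecMul x (M n))) ∧
      (∀ᶠ n in atTop, ∀ c : Fin (m n) → F, c ≠ 0 → Matrix.mulVec (M n) c = 0 →
        k n < hammingNorm c) ∧
      TwoProbeLowerBound (fun n x => Matrix.vecMul x (M n)) ∧
      MultiProbeLowerBound (fun n x => Matrix.vecMul x (M n))) ∧
    -- the bounds hold for all `k`-wise independent problems with `k = Θ(n / log n)`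
    (∀ (k : ℕ → ℕ) (f : (n : ℕ) → (Fin n → F) → Fin (m n) → F),
      (fun n => (k n : ℝ)) =Θ[atTop] (fun n : ℕ => (n : ℝ) / Real.logb 2 n) →
      (∀ᶠ n in atTop, KWiseIndependent (k n) (f n)) →
      TwoProbeLowerBound f ∧ MultiProbeLowerBound f) := by
  refine ⟨?_, fun k f hk hf => lowerBounds_of_kWiseIndependent hpoly hle hk hf⟩
  obtain ⟨q, K, _, _, _, a, hq, hq2, ha⟩ := exists_extension_not_pow F
  have : FiniteDimensional F K := Module.Finite.of_finite
  obtain ⟨D, -, hD⟩ := exists_eventually_le_pow hpoly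
  let M : (n : ℕ) → Matrix (Fin n) (Fin (m n)) F := fun n =>
    Matrix.of fun ρ i => codeEntry F (extDegree q D n) a ρ i
  -- The number of full powers whose coordinates over `F` fit into `n` rows.
  let k : ℕ → ℕ := fun n => n / (Module.finrank F K * extDegree q D n)
  have hk : (fun n => (k n : ℝ)) =Θ[atTop] (fun n : ℕ => (n : ℝ) / Real.logb 2 n) :=
    isTheta_div_extDegree hq.one_lt D Module.finrank_pos
  have hdist : ∀ᶠ n in atTop, ∀ c : Fin (m n) → F, c ≠ 0 → Matrix.mulVec (M n) c = 0 →
      k n < hammingNorm c := by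
    filter_upwards [hD] with n hn c hc hMc
    by_contra! hw
    -- Oddness of `q` makes `X ^ N - a` irreducible for all powers `N` of `q` at once.
    refine hc (eq_zero_of_codeEntry (X_pow_sub_C_irreducible_of_prime_pow hq hq2 _ ha)
      (extDegree_pos hq.one_lt D n) ?_ (Nat.div_mul_le_self _ _)
      (fun ρ hρ => congrFun hMc ⟨ρ, hρ⟩) hw)
    calc m n ≤ n ^ D := hn
      _ ≤ 2 ^ (D * (Nat.log 2 n + 1)) := le_two_pow_log n D
      _ ≤ 2 ^ extDegree q D n := Nat.pow_le_pow_right two_pos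
          ((Nat.mul_le_mul_right _ (Nat.lt_pow_self hq.one_lt).le).trans
            (le_extDegree hq.one_lt D n))
      _ ≤ Fintype.card K ^ extDegree q D n := Nat.pow_le_pow_left Fintype.one_lt_card _
  have hind : ∀ᶠ n in atTop, KWiseIndependent (k n) (fun x => Matrix.vecMul x (M n)) :=
    hdist.mono fun n h => kWiseIndependent_vecMul (M n) h
  exact ⟨k, M, hk, isExplicit_code hpoly hq.one_lt D a, hind, hdist,
    lowerBounds_of_kWiseIndependent hpoly hle hk hind⟩
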